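/- **Setting.** Let $k$ be a field, $M$ a lattice (a free abelian group of finite rank), and $M_{\mathbb R}=M\otimes_{\mathbb Z}\mathbb R$. A *fan* $\Delta$ in $M_{\mathbb R}$ is a finite nonempty set of rational polyhedral cones (not necessarily strongly convex) such that every face of a cone of $\Delta$ is in $\Delta$, and any two cones of $\Delta$ intersect in a common face. A *monoidal complex* $\mathcal M=(M,\Delta,(S_\sigma)_{\sigma\in\Delta})$ consists of such $M$, $\Delta$ and finitely generated submonoids $S_\sigma\subseteq M\cap\sigma$ generating the cone $\sigma$, for $\sigma\in\Delta$, such that $S_\tau=S_\sigma\cap\tau$ whenever $\tau$ is a face of $\sigma$. Its toric face ring $k[\mathcal M]$ is the $k$-algebra with basis $\chi^m$, $m\in\bigcup_\sigma S_\sigma$, in which $\chi^m\chi^{m'}=\chi^{m+m'}$ if $m,m'$ lie in a common $S_\sigma$, and $\chi^m\chi^{m'}=0$ otherwise. Let $X=\operatorname{Spec}k[\mathcal M]$. The dimension of a cone is the dimension of its linear span. The *facets* of $\Delta$ are its maximal cones. $\Delta$ is *1-connected* if for any two facets $F\neq F'$ there are facets $F=F_0,F_1,\dots,F_n=F'$ of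 $\Delta$, all containing $F\cap F'$, such that $F_i\cap F_{i+1}$ is a face of codimension one in both $F_i$ and $F_{i+1}$ for $0\le i<n$. For a facet $F$, let $(\tau_i)_i$ be the codimension one faces of $F$, and let $$S'_F=\bigcap_i\,(S_F-S_F\cap\tau_i),$$ the intersection being taken inside the group $S_F-S_F$ (so $S'_F=S_F-S_F$ if $F$ has no codimension one face). $X$ has *Serre's property $S_2$* if $\operatorname{depth}\mathcal O_{X,x}\ge\min(2,\dim\mathcal O_{X,x})$ for every $x\in X$. **Theorem 2.10.** $X$ satisfies Serre's property $S_2$ if and only if the following two conditions hold: 1. $\Delta$ is 1-connected; 2. for every $\sigma\in\Delta$, $S_\sigma=\{m\in M\cap\sigma : m\in S'_F \text{ for every facet } F \text{ of }\Delta\text{ containing } m\}$. -/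

import Mathlib

open scoped TensorProduct

noncomputable section

namespace ToricFace

universe u v

/-! ## Cones and fans in the real vector space of a lattice -/

section Fans

variable (M : Type u) [AddCommGroup M]

/-- The real vector space `M_ℝ = ℝ ⊗ M` of a lattice `M`. -/
abbrev RealSpace : Type u := ℝ ⊗[ℤ] M

/-- Convex cones in `M_ℝ` which contain the origin (they may contain lines). -/
abbrev Cone : Type u := PointedCone ℝ (RealSpace M)

variable {M}

/-- The canonical map `M → M_ℝ`. -/
def toReal (m : M) : RealSpace M := (1 : ℝ) ⊗ₜ[ℤ] m

/-- The cone in `M_ℝ` generated by a set of lattice points. -/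
def coneOf (A : Set M) : Cone M := PointedCone.hull ℝ (toReal '' A)

/-- A rational polyhedral cone is one generated by finitely many lattice points. -/
def IsRationalPolyhedral (σ : Cone M) : Prop :=
  ∃ A : Finset M, σ = coneOf (A : Set M)

/-- The dimension of a cone is the dimension of its linear span. -/
def coneDim (σ : Cone M) : ℕ :=
  Module.finrank ℝ (Submodule.span ℝ (σ : Set (RealSpace M)))

/-- `τ` is a face of `σ` of codimension one. -/
def IsCodimOneFace (τ σ : Cone M) : Prop :=
  PointedCone.IsFaceOf τ σ ∧ coneDim τ + 1 = coneDim σ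

variable (M) in
/-- A (finite, nonempty) fan of rational polyhedral cones in `M_ℝ`. The cones are not required to
be strongly convex, and the union of the cones is arbitrary. -/
structure Fan where
  /-- The cones of the fan. -/
  cones : Set (Cone M)
  finite : cones.Finite
  nonempty : cones.Nonempty
  rational : ∀ σ ∈ cones, IsRationalPolyhedral σ
  face_mem : ∀ σ ∈ cones, ∀ τ : Cone M, PointedCone.IsFaceOf τ σ → τ ∈ cones
  inter_face : ∀ σ ∈ cones, ∀ τ ∈ cones,
    PointedCone.IsFaceOf (σ ⊓ τ) σ ∧ PointedCone.IsFaceOf (σ ⊓ τ) τ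

/-- The facets of a fan are its maximal cones. -/
def Fan.IsFacet (Δ : Fan M) (F : Cone M) : Prop := Maximal (fun σ => σ ∈ Δ.cones) F

/-- A fan is `1`-connected if any two distinct facets `F`, `F'` are joined by a chain of facets
`F = G 0, G 1, …, G n = F'`, all containing `F ∩ F'`, such that `G i ∩ G (i + 1)` is a face of
codimension one in both `G i` and `G (i + 1)`. -/
def Fan.IsOneConnected (Δ : Fan M) : Prop :=
  ∀ F F' : Cone M, Δ.IsFacet F → Δ.IsFacet F' → F ≠ F' →
    ∃ (n : ℕ) (G : ℕ → Cone M), G 0 = F ∧ G n = F' ∧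
      (∀ i ≤ n, Δ.IsFacet (G i) ∧ F ⊓ F' ≤ G i) ∧
      (∀ i < n, IsCodimOneFace (G i ⊓ G (i + 1)) (G i) ∧
        IsCodimOneFace (G i ⊓ G (i + 1)) (G (i + 1)))

/-- The `S₂`-closure `S' = ⋂ᵢ (S - S ∩ τᵢ)` of a semigroup `S ⊆ M`, where the `τᵢ` are the
codimension one faces of the cone generated by `S`. The intersection is formed inside the group
`S - S`, so that `S' = S - S` if there are no codimension one faces. -/
def s2Closure (S : AddSubmonoid M) : Set M :=
  {m | (∃ s ∈ S, ∃ t ∈ S, m = s - t) ∧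
    ∀ τ : Cone M, IsCodimOneFace τ (coneOf (S : Set M)) →
      ∃ s ∈ S, ∃ t ∈ S, toReal t ∈ τ ∧ m = s - t}

end Fans

/-! ## Monoidal complexes and their toric face rings -/

/-- A monoidal complex `(M, Δ, (S_σ))`: a fan `Δ` in `M_ℝ` and, for every cone `σ` of `Δ`, a
finitely generated semigroup `S_σ ⊆ M` which generates the cone `σ`, such that
`S_τ = S_σ ∩ τ` for every face `τ` of `σ`. -/
structure MonoidalComplex (M : Type u) [AddCommGroup M] where
  fan : Fan M
  /-- The semigroups `S_σ`. -/
  S : fan.cones → AddSubmonoid M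
  fg : ∀ σ, (S σ).FG
  generates : ∀ σ : fan.cones, coneOf (S σ : Set M) = σ
  face : ∀ σ τ : fan.cones, PointedCone.IsFaceOf (τ : Cone M) (σ : Cone M) →
    (S τ : Set M) = {m | m ∈ S σ ∧ toReal m ∈ (τ : Cone M)}

namespace MonoidalComplex

variable {M : Type u} [AddCommGroup M] (𝓜 : MonoidalComplex M)

/-- The set `|𝓜| = ⋃ S_σ`. -/
def support : Set M := {m | ∃ σ, m ∈ 𝓜.S σ}

/-- Two lattice points are compatible if they lie in a common semigroup `S_σ`. -/
def Compatible (a b : M) : Prop := ∃ σ, a ∈ 𝓜.S σ ∧ b ∈ 𝓜.S σ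

variable {𝓜}

theorem toReal_mem {σ : 𝓜.fan.cones} {m : M} (hm : m ∈ 𝓜.S σ) :
    toReal m ∈ (σ : Cone M) := by
  have h : toReal m ∈ coneOf (𝓜.S σ : Set M) :=
    PointedCone.subset_hull ⟨m, hm, rfl⟩
  rwa [𝓜.generates σ] at h

theorem toReal_add (a b : M) : toReal (a + b) = toReal a + toReal b :=
  TensorProduct.tmul_add _ _ _

theorem mem_of_toReal_mem {σ τ : 𝓜.fan.cones} {m : M} (hm : m ∈ 𝓜.S σ)
    (hτ : toReal m ∈ (τ : Cone M)) : m ∈ 𝓜.S τ := by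
  obtain ⟨h1, h2⟩ := 𝓜.fan.inter_face σ σ.2 τ τ.2
  let ρ : 𝓜.fan.cones := ⟨σ ⊓ τ, 𝓜.fan.face_mem σ σ.2 _ h1⟩
  have hρ : m ∈ (𝓜.S ρ : Set M) := by
    rw [𝓜.face σ ρ h1]
    exact ⟨hm, toReal_mem hm, hτ⟩
  rw [𝓜.face τ ρ h2] at hρ
  exact hρ.1

theorem mem_of_add_mem {σ τ : 𝓜.fan.cones} {a b : M} (ha : a ∈ 𝓜.S σ) (hb : b ∈ 𝓜.S σ)
    (hab : a + b ∈ 𝓜.S τ) : a ∈ 𝓜.S τ ∧ b ∈ 𝓜.S τ := by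
  have h1 := (𝓜.fan.inter_face σ σ.2 τ τ.2).1
  have hmem : toReal a + toReal b ∈ (σ : Cone M) ⊓ (τ : Cone M) := by
    rw [← toReal_add]
    exact ⟨toReal_mem (add_mem ha hb), toReal_mem hab⟩
  exact ⟨mem_of_toReal_mem ha (h1.mem_of_add_mem_left (toReal_mem ha) (toReal_mem hb) hmem).2,
    mem_of_toReal_mem hb (h1.mem_of_add_mem_right (toReal_mem ha) (toReal_mem hb) hmem).2⟩

theorem Compatible.symm {a b : M} (h : 𝓜.Compatible a b) : 𝓜.Compatible b a :=
  let ⟨σ, ha, hb⟩ := h; ⟨σ, hb, ha⟩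

theorem Compatible.add_mem {a b : M} (h : 𝓜.Compatible a b) : a + b ∈ 𝓜.support :=
  let ⟨σ, ha, hb⟩ := h; ⟨σ, AddMemClass.add_mem ha hb⟩

variable (𝓜)

theorem zero_mem_support : (0 : M) ∈ 𝓜.support :=
  let ⟨σ, hσ⟩ := 𝓜.fan.nonempty; ⟨⟨σ, hσ⟩, zero_mem _⟩

end MonoidalComplex

/-- The toric face ring `k[𝓜]`, as a vector space: it has the basis `χ^m`, `m ∈ |𝓜|`. -/
def ToricFaceRing (k : Type v) [CommRing k] {M : Type u} [AddCommGroup M]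
    (𝓜 : MonoidalComplex M) : Type (max u v) := 𝓜.support →₀ k

namespace ToricFaceRing

variable {k : Type v} [CommRing k] {M : Type u} [AddCommGroup M] {𝓜 : MonoidalComplex M}

instance : AddCommGroup (ToricFaceRing k 𝓜) := inferInstanceAs (AddCommGroup (𝓜.support →₀ k))

instance : Module k (ToricFaceRing k 𝓜) := inferInstanceAs (Module k (𝓜.support →₀ k))

variable (k 𝓜) in
/-- The basis `(χ^m)` of the toric face ring. -/
def basis : Module.Basis 𝓜.support k (ToricFaceRing k 𝓜) := Finsupp.basisSingleOne

variable (k) in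
/-- The element `χ^m` of the toric face ring. -/
def chi (m : 𝓜.support) : ToricFaceRing k 𝓜 := basis k 𝓜 m

open scoped Classical in
variable (k) in
/-- The product `χ^a χ^b`: it is `χ^(a + b)` if `a` and `b` lie in a common semigroup `S_σ`,
and `0` otherwise. -/
def chiMul (a b : 𝓜.support) : ToricFaceRing k 𝓜 :=
  if h : 𝓜.Compatible (a : M) (b : M) then chi k ⟨(a : M) + b, h.add_mem⟩ else 0

variable (k 𝓜) in
/-- The multiplication of the toric face ring: the bilinear extension of `chiMul`. -/
def mulBilin : ToricFaceRing k 𝓜 →ₗ[k] ToricFaceRing k 𝓜 →ₗ[k] ToricFaceRing k 𝓜 :=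
  (basis k 𝓜).constr k fun a => (basis k 𝓜).constr k fun b => chiMul k a b

instance : Mul (ToricFaceRing k 𝓜) := ⟨fun f g => mulBilin k 𝓜 f g⟩

instance : One (ToricFaceRing k 𝓜) := ⟨chi k ⟨0, 𝓜.zero_mem_support⟩⟩

theorem mul_def (f g : ToricFaceRing k 𝓜) : f * g = mulBilin k 𝓜 f g := rfl

theorem one_def : (1 : ToricFaceRing k 𝓜) = chi k ⟨0, 𝓜.zero_mem_support⟩ := rfl

theorem mulBilin_chi (a b : 𝓜.support) :
    mulBilin k 𝓜 (chi k a) (chi k b) = chiMul k a b := by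
  simp [mulBilin, chi]

theorem chiMul_comm (a b : 𝓜.support) : chiMul k a b = chiMul k b a := by
  unfold chiMul
  by_cases h : 𝓜.Compatible (a : M) (b : M)
  · rw [dif_pos h, dif_pos h.symm]
    simp only [add_comm]
  · rw [dif_neg h, dif_neg fun h' => h h'.symm]

open scoped Classical in
theorem mulBilin_chiMul (a b c : 𝓜.support) :
    mulBilin k 𝓜 (chiMul k a b) (chi k c) =
      if h : ∃ σ, (a : M) ∈ 𝓜.S σ ∧ (b : M) ∈ 𝓜.S σ ∧ (c : M) ∈ 𝓜.S σ then
        chi k ⟨(a : M) + b + c, let ⟨σ, ha, hb, hc⟩ := h; ⟨σ, add_mem (add_mem ha hb) hc⟩⟩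
      else 0 := by
  by_cases hab : 𝓜.Compatible (a : M) (b : M)
  · rw [chiMul, dif_pos hab, mulBilin_chi, chiMul]
    by_cases h : 𝓜.Compatible ((a : M) + b) (c : M)
    · have h3 : ∃ σ, (a : M) ∈ 𝓜.S σ ∧ (b : M) ∈ 𝓜.S σ ∧ (c : M) ∈ 𝓜.S σ := by
        obtain ⟨σ, ha, hb⟩ := hab
        obtain ⟨τ, hs, hc⟩ := h
        have := MonoidalComplex.mem_of_add_mem ha hb hs
        exact ⟨τ, this.1, this.2, hc⟩
      rw [dif_pos h, dif_pos h3]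
    · rw [dif_neg h, dif_neg]
      rintro ⟨σ, ha, hb, hc⟩
      exact h ⟨σ, add_mem ha hb, hc⟩
  · rw [chiMul, dif_neg hab, map_zero, LinearMap.zero_apply, dif_neg]
    rintro ⟨σ, ha, hb, -⟩
    exact hab ⟨σ, ha, hb⟩

theorem mul_comm' (f g : ToricFaceRing k 𝓜) : f * g = g * f := by
  have h : mulBilin k 𝓜 = (mulBilin k 𝓜).flip := by
    refine (basis k 𝓜).ext fun a => (basis k 𝓜).ext fun b => ?_
    rw [LinearMap.flip_apply]
    exact (mulBilin_chi a b).trans ((chiMul_comm a b).trans (mulBilin_chi b a).symm)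
  rw [mul_def, mul_def]
  exact LinearMap.congr_fun₂ h f g

theorem chi_mul_assoc (a b c : 𝓜.support) :
    chi k a * chi k b * chi k c = chi k a * (chi k b * chi k c) := by
  rw [mul_comm' (chi k a) (chi k b * chi k c)]
  simp only [mul_def]
  rw [mulBilin_chi, mulBilin_chi, mulBilin_chiMul, mulBilin_chiMul]
  by_cases h : ∃ σ, (a : M) ∈ 𝓜.S σ ∧ (b : M) ∈ 𝓜.S σ ∧ (c : M) ∈ 𝓜.S σ
  · have h' : ∃ σ, (b : M) ∈ 𝓜.S σ ∧ (c : M) ∈ 𝓜.S σ ∧ (a : M) ∈ 𝓜.S σ := by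
      obtain ⟨σ, ha, hb, hc⟩ := h
      exact ⟨σ, hb, hc, ha⟩
    rw [dif_pos h, dif_pos h']
    congr 2
    abel
  · rw [dif_neg h, dif_neg]
    rintro ⟨σ, hb, hc, ha⟩
    exact h ⟨σ, ha, hb, hc⟩

theorem mul_assoc' (f g h : ToricFaceRing k 𝓜) : f * g * h = f * (g * h) := by
  let L := mulBilin k 𝓜
  have key : L.compr₂ L = (LinearMap.llcomp k _ _ _).compl₂ L ∘ₗ L := by
    refine (basis k 𝓜).ext fun a => (basis k 𝓜).ext fun b => (basis k 𝓜).ext fun c => ?_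
    exact chi_mul_assoc a b c
  exact LinearMap.congr_fun (LinearMap.congr_fun₂ key f g) h

theorem one_mul' (f : ToricFaceRing k 𝓜) : 1 * f = f := by
  have h : mulBilin k 𝓜 1 = LinearMap.id := by
    refine (basis k 𝓜).ext fun b => ?_
    refine (mulBilin_chi _ b).trans ?_
    obtain ⟨b, σ, hb⟩ := b
    have hc : 𝓜.Compatible (0 : M) b := ⟨σ, zero_mem _, hb⟩
    rw [chiMul, dif_pos hc]
    simp [chi]
  exact LinearMap.congr_fun h f

instance : CommRing (ToricFaceRing k 𝓜) :=
  { (inferInstance : AddCommGroup (ToricFaceRing k 𝓜)) with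
    mul := (· * ·)
    one := 1
    mul_assoc := mul_assoc'
    one_mul := one_mul'
    mul_one := fun f => (mul_comm' f 1).trans (one_mul' f)
    mul_comm := mul_comm'
    zero_mul := fun f => by simp [mul_def]
    mul_zero := fun f => by simp [mul_def]
    left_distrib := fun f g h => by simp [mul_def]
    right_distrib := fun f g h => by simp [mul_def] }

end ToricFaceRing

/-- The affine toric variety `X = Spec k[𝓜]`. -/
def toricVariety (k : Type v) [Field k] {M : Type u} [AddCommGroup M]
    (𝓜 : MonoidalComplex M) : AlgebraicGeometry.Scheme.{max u v} :=
  AlgebraicGeometry.Spec (CommRingCat.of (ToricFaceRing k 𝓜))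

/-! ## Serre's property -/

/-- The depth of a local ring: the supremum of the lengths of the regular sequences contained in
its maximal ideal. -/
def localDepth (R : Type u) [CommRing R] [IsLocalRing R] : ℕ∞ :=
  ⨆ (rs : List R) (_ : (∀ r ∈ rs, r ∈ IsLocalRing.maximalIdeal R) ∧
    RingTheory.Sequence.IsRegular R rs), (rs.length : ℕ∞)

/-- Serre's property `S_n` of a scheme: `depth 𝒪_{X,x} ≥ min (n, dim 𝒪_{X,x})` for every point
`x` of `X`. -/
def SatisfiesSerre (X : AlgebraicGeometry.Scheme.{u}) (n : ℕ) : Prop :=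
  ∀ x : X, min (n : WithBot ℕ∞) (ringKrullDim (X.presheaf.stalk x)) ≤
    ((localDepth (X.presheaf.stalk x) : ℕ∞) : WithBot ℕ∞)

end ToricFace

end

noncomputable section

namespace ToricFace

universe u v

/-! ### Faces and relative interiors of cones -/

section Cones

variable {V : Type*} [AddCommGroup V] [Module ℝ V]

/-! For a Noetherian ring whose primes of positive height all contain a nonzerodivisor, S₂ means
that a fraction w/x, with x a nonzerodivisor, lies in the ring as soon as it does so locally at
every prime of height at most one (`DvdInCodimOne`, `satisfiesSerre_two_iff`). The toric face ring
is of this kind: its minimal primes are the kernels of the projections to the k[S_F], F a facet, and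
it embeds in the product of these domains. The question becomes which families (z_F) of Laurent
polynomials come from the ring.

Conditions imply S₂. Let w/x be defined in codimension one. On a facet F it is a Laurent polynomial
z_F, because k[S_F - S_F] is factorial and its height one primes contract to primes of height at
most one (`exists_proj_eq_mul`). By 1-connectedness all facets have the same dimension, so a
codimension one face τ of one facet has codimension one in every facet containing it, and its prime
has height at most one by Krull's theorem (`height_conePrime_le_one`). Testing w/x at these primes
shows that z_F is supported in S'_F (`mem_s2Closure_of_coeff_ne`) and that z_F and z_G agree on F ∩
G when this is a common codimension one face (`coeff_eq_of_isCodimOneFace`). Chains of facets extend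
the agreement to all pairs, condition 2 moves the supports into the S_F, and the z_F glue.

S₂ implies the conditions. For a set A of facets and a lattice point m, consider the family which is
χ^m on A and 0 elsewhere. By S₂ it comes from the ring if, for every cone that can belong to a prime
of height at most one, some monomial of that cone multiplies it into the ring
(`exists_proj_eq_single`). With A the facets containing m this gives condition 2. With m interior to
F ∩ F' and A the facets reachable from F by admissible chains, it gives an element whose coefficient
at m is 1 seen from F, but 0 seen from F' if F' is not reachable.

The convex geometry supplies semigroup elements in relative interiors (order units), multiples of
lattice points of a cone that lie in the semigroup, and the description of a cone by its codimension
one faces. -/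

theorem natCast_smul_mem {C : PointedCone ℝ V} {x : V} (hx : x ∈ C) (n : ℕ) : (n : ℝ) • x ∈ C :=
  PointedCone.smul_mem C n.cast_nonneg hx

/-- The smallest face of `C` containing `u ∈ C`. -/
def minFace (C : PointedCone ℝ V) (u : V) : PointedCone ℝ V where
  carrier := {a | a ∈ C ∧ ∃ N : ℕ, (N : ℝ) • u - a ∈ C}
  add_mem' := by
    rintro a b ⟨ha, N, hN⟩ ⟨hb, K, hK⟩
    refine ⟨add_mem ha hb, N + K, ?_⟩
    have : ((N + K : ℕ) : ℝ) • u - (a + b) = ((N : ℝ) • u - a) + ((K : ℝ) • u - b) := by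
      push_cast; module
    rw [this]
    exact add_mem hN hK
  zero_mem' := ⟨zero_mem _, 0, by simp⟩
  smul_mem' := by
    rintro ⟨c, hc⟩ a ⟨ha, N, hN⟩
    refine ⟨PointedCone.smul_mem C hc ha, ⌈c⌉₊ * N, ?_⟩
    have : ((⌈c⌉₊ * N : ℕ) : ℝ) • u - c • a =
        (⌈c⌉₊ : ℝ) • ((N : ℝ) • u - a) + ((⌈c⌉₊ : ℝ) - c) • a := by
      push_cast; module
    change _ - c • a ∈ C
    rw [this]
    exact add_mem (natCast_smul_mem hN _)
      (PointedCone.smul_mem C (sub_nonneg.2 (Nat.le_ceil c)) ha)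

theorem minFace_isFaceOf (C : PointedCone ℝ V) (u : V) : (minFace C u).IsFaceOf C := by
  refine PointedCone.IsFaceOf.of_mem_of_add_mem_left (fun a ha => ha.1) ?_
  rintro x y hx hy ⟨-, N, hN⟩
  refine ⟨hx, N, ?_⟩
  have : (N : ℝ) • u - x = ((N : ℝ) • u - (x + y)) + y := by abel
  rw [this]
  exact add_mem hN hy

theorem self_mem_minFace {C : PointedCone ℝ V} {u : V} (hu : u ∈ C) : u ∈ minFace C u :=
  ⟨hu, 1, by simp⟩

/-- Every element of `C` is dominated by a multiple of `u ∈ C`. -/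
def IsOrderUnit (C : PointedCone ℝ V) (u : V) : Prop :=
  u ∈ C ∧ ∀ a ∈ C, ∃ N : ℕ, (N : ℝ) • u - a ∈ C

theorem isOrderUnit_minFace {C : PointedCone ℝ V} {u : V} (hu : u ∈ C) :
    IsOrderUnit (minFace C u) u := by
  refine ⟨self_mem_minFace hu, ?_⟩
  rintro a ⟨ha, N, hN⟩
  exact ⟨N, hN, N, by simpa using ha⟩

/-- An order unit plays the role of a relative interior point: a face through it absorbs each a,
since a and N u - a add up to an element of the face. -/
theorem IsOrderUnit.le_of_mem {C τ D : PointedCone ℝ V} {u : V} (h : IsOrderUnit C u)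
    (hτ : τ.IsFaceOf D) (hCD : C ≤ D) (hu : u ∈ τ) : C ≤ τ := by
  intro a ha
  obtain ⟨N, hN⟩ := h.2 a ha
  exact hτ.mem_of_add_mem_left (hCD ha) (hCD hN) (by simpa using natCast_smul_mem hu N)

theorem IsOrderUnit.add {C : PointedCone ℝ V} {u v : V} (h : IsOrderUnit C u) (hv : v ∈ C) :
    IsOrderUnit C (u + v) := by
  refine ⟨add_mem h.1 hv, fun a ha => ?_⟩
  obtain ⟨N, hN⟩ := h.2 a ha
  refine ⟨N, ?_⟩
  have : (N : ℝ) • (u + v) - a = ((N : ℝ) • u - a) + (N : ℝ) • v := by module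
  rw [this]
  exact add_mem hN (natCast_smul_mem hv N)

/-- The sum of the generators minus one of them is the sum of the others, so the smallest face of
the sum contains all generators. -/
theorem exists_isOrderUnit_hull (A : Finset V) :
    IsOrderUnit (PointedCone.hull ℝ (A : Set V)) (∑ a ∈ A, a) := by
  have hA : ∀ a ∈ A, a ∈ PointedCone.hull ℝ (A : Set V) := fun a ha =>
    PointedCone.subset_hull ha
  have hmem : ∑ a ∈ A, a ∈ PointedCone.hull ℝ (A : Set V) := sum_mem hA
  refine ⟨hmem, ?_⟩
  have key : PointedCone.hull ℝ (A : Set V) ≤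
      minFace (PointedCone.hull ℝ (A : Set V)) (∑ a ∈ A, a) := by
    refine Submodule.span_le.2 fun a ha => ⟨hA a ha, 1, ?_⟩
    classical
    have : ((1 : ℕ) : ℝ) • (∑ a ∈ A, a) - a = ∑ b ∈ A.erase a, b := by
      rw [← Finset.add_sum_erase A (fun a => a) ha]; simp
    rw [this]
    exact sum_mem fun b hb => hA b (Finset.mem_of_mem_erase hb)
  exact fun a ha => (key ha).2

theorem exists_sub_of_mem_span {C : PointedCone ℝ V} {x : V}
    (hx : x ∈ Submodule.span ℝ (C : Set V)) : ∃ p ∈ C, ∃ q ∈ C, x = p - q := by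
  induction hx using Submodule.span_induction with
  | mem x h => exact ⟨x, h, 0, zero_mem _, by simp⟩
  | zero => exact ⟨0, zero_mem _, 0, zero_mem _, by simp⟩
  | add x y _ _ hx hy =>
    obtain ⟨p, hp, q, hq, rfl⟩ := hx
    obtain ⟨p', hp', q', hq', rfl⟩ := hy
    exact ⟨p + p', add_mem hp hp', q + q', add_mem hq hq', by abel⟩
  | smul c x _ hx =>
    obtain ⟨p, hp, q, hq, rfl⟩ := hx
    rcases le_total 0 c with hc | hc
    · exact ⟨c • p, PointedCone.smul_mem C hc hp, c • q, PointedCone.smul_mem C hc hq,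
        smul_sub _ _ _⟩
    · refine ⟨(-c) • q, PointedCone.smul_mem C (neg_nonneg.2 hc) hq, (-c) • p,
        PointedCone.smul_mem C (neg_nonneg.2 hc) hp, by module⟩

/-- Write a = p - q with p, q in τ; then a + q lies in the face, hence so does a. -/
theorem mem_face_of_mem_span {τ C : PointedCone ℝ V} (h : τ.IsFaceOf C) {a : V} (ha : a ∈ C)
    (hs : a ∈ Submodule.span ℝ (τ : Set V)) : a ∈ τ := by
  obtain ⟨p, hp, q, hq, rfl⟩ := exists_sub_of_mem_span hs
  exact h.mem_of_add_mem_left ha (h.le hq) (by simpa using hp)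

theorem span_lt_span_of_face {τ C : PointedCone ℝ V} (h : τ.IsFaceOf C) (hne : τ ≠ C) :
    Submodule.span ℝ (τ : Set V) < Submodule.span ℝ (C : Set V) := by
  refine lt_of_le_of_ne (Submodule.span_mono h.le) fun he => hne (le_antisymm h.le fun a ha => ?_)
  exact mem_face_of_mem_span h ha (he ▸ Submodule.subset_span ha)

/-- If a proper face `τ` of a finitely generated cone is maximal, then the cone is contained in
`span τ + ℝ s` for some `s ∉ span τ`. -/
theorem exists_le_span_sup_of_maximal {τ : PointedCone ℝ V} {A : Set V} (hA : A.Finite)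
    (h : τ.IsFaceOf (PointedCone.hull ℝ A)) (hne : τ ≠ PointedCone.hull ℝ A)
    {u : V} (hu : IsOrderUnit τ u)
    (hmax : ∀ ρ : PointedCone ℝ V, ρ.IsFaceOf (PointedCone.hull ℝ A) → τ ≤ ρ →
      ρ = τ ∨ ρ = PointedCone.hull ℝ A) :
    ∃ s ∉ Submodule.span ℝ (τ : Set V), ∀ a ∈ A,
      a ∈ Submodule.span ℝ (τ : Set V) ⊔ Submodule.span ℝ {s} := by
  classical
  set F := PointedCone.hull ℝ A with hF
  let W : PointedCone ℝ V := PointedCone.ofSubmodule (Submodule.span ℝ (τ : Set V))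
  let K : Finset V → PointedCone ℝ V := fun B => W ⊔ PointedCone.hull ℝ (B : Set V)
  -- B is a minimal set of generators of the cone modulo span τ. The aim is to show that it is a
  -- single ray.
  obtain ⟨B, ⟨hBF, hBK⟩, hBmin⟩ := exists_minimal_of_wellFoundedLT
    (fun B : Finset V => (B : Set V) ⊆ F ∧ F ≤ K B)
    ⟨hA.toFinset, by
      rw [hA.coe_toFinset]
      exact ⟨PointedCone.subset_hull, by simp only [K, hA.coe_toFinset]; exact le_sup_right⟩⟩
  have hKins : ∀ (D : Finset V) (s : V), s ∈ K D → K (insert s D) ≤ K D := by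
    intro D s hs
    refine sup_le le_sup_left (Submodule.span_le.2 fun x hx => ?_)
    rcases Finset.mem_insert.1 hx with rfl | hx
    · exact hs
    · exact (le_sup_right : _ ≤ K D) (PointedCone.subset_hull hx)
  have hmin : ∀ s ∈ B, s ∉ K (B.erase s) := by
    intro s hs hsK
    have h1 : F ≤ K (B.erase s) := by
      refine hBK.trans ?_
      have := hKins _ _ hsK
      rwa [Finset.insert_erase hs] at this
    have := hBmin ⟨(Finset.coe_subset.2 (B.erase_subset s)).trans hBF, h1⟩ (B.erase_subset s)
    exact Finset.notMem_erase s B (this hs)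
  have hspan : ∀ s ∈ B, s ∉ Submodule.span ℝ (τ : Set V) := fun s hs hs' =>
    hmin s hs ((le_sup_left : W ≤ K _) hs')
  have hBne : B.Nonempty := by
    rw [Finset.nonempty_iff_ne_empty]
    rintro rfl
    refine hne (le_antisymm h.le fun a ha => mem_face_of_mem_span h ha ?_)
    have := hBK ha
    simp only [K, Finset.coe_empty, PointedCone.hull, Submodule.span_empty, sup_bot_eq] at this
    exact this
  obtain ⟨s, hs⟩ := hBne
  have hsF : s ∈ F := hBF hs
  -- The smallest face containing u + s contains τ and s, so by maximality it is all of F. Thus N (u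
  -- + s) - b ∈ F for some N, and the coefficient c of s in this element is compared with N: if c ≥
  -- N then b falls into τ, otherwise s is redundant in B.
  have hsingle : ∀ b ∈ B, b = s := by
    intro b hb
    by_contra hbs
    have huF : u + s ∈ F := add_mem (h.le hu.1) hsF
    have hle : τ ≤ minFace F (u + s) := by
      intro a ha
      obtain ⟨N, hN⟩ := hu.2 a ha
      refine ⟨h.le ha, N, ?_⟩
      have : (N : ℝ) • (u + s) - a = ((N : ℝ) • u - a) + (N : ℝ) • s := by module
      rw [this]
      exact add_mem (h.le hN) (natCast_smul_mem hsF N)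
    have hsm : s ∈ minFace F (u + s) :=
      (minFace_isFaceOf F _).mem_of_add_mem_right (h.le hu.1) hsF (self_mem_minFace huF)
    rcases hmax _ (minFace_isFaceOf F (u + s)) hle with he | he
    · rw [he] at hsm
      exact hspan s hs (Submodule.subset_span hsm)
    have hbm : b ∈ minFace F (u + s) := by rw [he]; exact hBF hb
    obtain ⟨-, N, hN⟩ := hbm
    have hNK := hBK hN
    rw [← Finset.insert_erase hs] at hNK
    obtain ⟨w, hw, y, hy, hwy⟩ := Submodule.mem_sup.1 hNK
    rw [Finset.coe_insert] at hy
    obtain ⟨c, y', hy', rfl⟩ := Submodule.mem_span_insert.1 hy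
    have hy'F : y' ∈ F := (Submodule.span_le.2 fun x hx =>
      hBF (Finset.mem_of_mem_erase hx) : PointedCone.hull ℝ ((B.erase s : Finset V) : Set V) ≤ F)
      hy'
    have hcs : c • s = (c : ℝ) • s := rfl
    rw [hcs] at hwy
    have hnu : (N : ℝ) • u ∈ Submodule.span ℝ (τ : Set V) :=
      Submodule.smul_mem _ _ (Submodule.subset_span hu.1)
    rcases le_or_gt (N : ℝ) c with hc | hc
    · have hsum : b + (y' + ((c : ℝ) - N) • s) ∈ τ := by
        refine mem_face_of_mem_span h (add_mem (hBF hb) (add_mem hy'F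
          (PointedCone.smul_mem F (sub_nonneg.2 hc) hsF))) ?_
        have : b + (y' + ((c : ℝ) - N) • s) = (N : ℝ) • u - w := by
          have : w = ((N : ℝ) • (u + s) - b) - ((c : ℝ) • s + y') := by rw [← hwy]; abel
          rw [this]; module
        rw [this]
        exact sub_mem hnu hw
      exact hspan b hb (Submodule.subset_span (h.mem_of_add_mem_left (hBF hb) (add_mem hy'F
          (PointedCone.smul_mem F (sub_nonneg.2 hc) hsF)) hsum))
    · refine hmin s hs ?_
      have hpos : (0 : ℝ) < N - c := sub_pos.2 hc
      have hmem : ((N : ℝ) - c) • s ∈ K (B.erase s) := by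
        have : ((N : ℝ) - c) • s = (w - (N : ℝ) • u) + (b + y') := by
          have : w = ((N : ℝ) • (u + s) - b) - ((c : ℝ) • s + y') := by rw [← hwy]; abel
          rw [this]; module
        rw [this]
        refine add_mem ((le_sup_left : W ≤ K _)
          (show w - (N : ℝ) • u ∈ Submodule.span ℝ (τ : Set V) from sub_mem hw hnu))
          ((le_sup_right : _ ≤ K _) ?_)
        exact add_mem (PointedCone.subset_hull (Finset.mem_coe.2 (Finset.mem_erase.2 ⟨hbs, hb⟩)))
          hy'
      have := PointedCone.smul_mem (K (B.erase s)) (inv_nonneg.2 hpos.le) hmem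
      rwa [smul_smul, inv_mul_cancel₀ hpos.ne', one_smul] at this
  refine ⟨s, hspan s hs, fun a ha => ?_⟩
  have hle : K B ≤ PointedCone.ofSubmodule
      (Submodule.span ℝ (τ : Set V) ⊔ Submodule.span ℝ {s}) := by
    refine sup_le (fun x hx => (le_sup_left : Submodule.span ℝ (τ : Set V) ≤ _) hx)
      (Submodule.span_le.2 fun x hx => ?_)
    rw [hsingle x hx]
    exact (le_sup_right : Submodule.span ℝ {s} ≤ _) (Submodule.mem_span_singleton_self s)
  exact hle (hBK (PointedCone.subset_hull ha))

end Cones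

/-! ### Carathéodory's theorem and closedness of finitely generated cones -/

section Caratheodory

variable {V : Type*} [AddCommGroup V] [Module ℝ V]

theorem mem_hull_finset_iff {A : Finset V} {x : V} :
    x ∈ PointedCone.hull ℝ (A : Set V) ↔
      ∃ c : V → ℝ, (∀ a, 0 ≤ c a) ∧ ∑ a ∈ A, c a • a = x := by
  constructor
  · intro h
    obtain ⟨f, -, hf⟩ := Submodule.mem_span_finset.1 h
    exact ⟨fun a => f a, fun a => (f a).2, hf⟩
  · rintro ⟨c, hc, rfl⟩
    exact sum_mem fun a ha => PointedCone.smul_mem _ (hc a) (PointedCone.subset_hull ha)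

/-- Carathéodory: a linear relation among the generators of a minimal subset would allow one of them
to be eliminated. -/
theorem exists_linearIndepOn_of_mem_hull {A : Finset V} {x : V}
    (hx : x ∈ PointedCone.hull ℝ (A : Set V)) :
    ∃ B ⊆ A, LinearIndepOn ℝ id (B : Set V) ∧ x ∈ PointedCone.hull ℝ (B : Set V) := by
  classical
  obtain ⟨B, hBA, hB⟩ := exists_minimal_le_of_wellFoundedLT
    (fun B : Finset V => x ∈ PointedCone.hull ℝ (B : Set V)) A hx
  refine ⟨B, hBA, ?_, hB.prop⟩
  by_contra hli
  have hg : ∃ g : V → ℝ, ∑ i ∈ B, g i • i = 0 ∧ ∃ i ∈ B, 0 < g i := by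
    rw [linearIndepOn_finset_iff] at hli
    push Not at hli
    obtain ⟨g, hg, i, hi, hgi⟩ := hli
    rcases lt_or_gt_of_ne hgi with h | h
    · exact ⟨fun i => -g i, by simpa using hg, i, hi, neg_pos.2 h⟩
    · exact ⟨g, hg, i, hi, h⟩
  obtain ⟨g, hg, i₀, hi₀, hgi₀⟩ := hg
  obtain ⟨c, hc, hcx⟩ := mem_hull_finset_iff.1 hB.prop
  -- Subtracting the smallest ratio c/g times the relation kills the coefficient of b and keeps the
  -- others nonnegative.
  obtain ⟨b, hb, hbmin⟩ := (B.filter (0 < g ·)).exists_min_image (fun a => c a / g a)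
    ⟨i₀, Finset.mem_filter.2 ⟨hi₀, hgi₀⟩⟩
  obtain ⟨hbB, hgb⟩ := Finset.mem_filter.1 hb
  set t := c b / g b with ht
  have ht0 : 0 ≤ t := div_nonneg (hc b) hgb.le
  have hnn : ∀ a ∈ B, 0 ≤ c a - t * g a := by
    intro a ha
    rcases le_or_gt (g a) 0 with h | h
    · nlinarith [hc a, mul_nonneg ht0 (neg_nonneg.2 h)]
    · have := hbmin a (Finset.mem_filter.2 ⟨ha, h⟩)
      rw [le_div_iff₀ h] at this
      exact sub_nonneg.2 this
  have hmem : x ∈ PointedCone.hull ℝ ((B.erase b : Finset V) : Set V) := by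
    have hsum : x = ∑ a ∈ B.erase b, (c a - t * g a) • a := by
      have h1 : x = ∑ a ∈ B, (c a - t * g a) • a := by
        simp only [sub_smul, mul_smul, Finset.sum_sub_distrib, ← Finset.smul_sum, hg, hcx]
        simp
      rw [h1, ← Finset.add_sum_erase B _ hbB]
      have : c b - t * g b = 0 := by rw [ht, div_mul_cancel₀ _ hgb.ne', sub_self]
      rw [this, zero_smul, zero_add]
    rw [hsum]
    exact sum_mem fun a ha => PointedCone.smul_mem _ (hnn a (Finset.mem_of_mem_erase ha))
      (PointedCone.subset_hull ha)
  exact Finset.notMem_erase b B (hB.le_of_le hmem (B.erase_subset b) hbB)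

/-- Finitely generated cones are closed along lines. -/
theorem mem_hull_of_forall_add_smul_mem {A : Finset V} {v w : V}
    (h : ∀ n : ℕ, v + ((n : ℝ) + 1)⁻¹ • w ∈ PointedCone.hull ℝ (A : Set V)) :
    v ∈ PointedCone.hull ℝ (A : Set V) := by
  classical
  choose B hBA hli hB using fun n => exists_linearIndepOn_of_mem_hull (h n)
  -- Pigeonhole: one linearly independent set D works for infinitely many n. In the basis D the
  -- coordinates of v + w/(n+1) are α + β/(n+1) ≥ 0, which forces α ≥ 0.
  obtain ⟨⟨D, hD⟩, hinf⟩ := Finite.exists_infinite_fiber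
    (fun n => (⟨B n, Finset.mem_powerset.2 (hBA n)⟩ : A.powerset))
  have hinf := Set.infinite_coe_iff.1 hinf
  have hmem : ∀ n ∈ (fun n => (⟨B n, Finset.mem_powerset.2 (hBA n)⟩ : A.powerset)) ⁻¹' {⟨D, hD⟩},
      B n = D := fun n hn => congrArg Subtype.val hn
  set T := (fun n => (⟨B n, Finset.mem_powerset.2 (hBA n)⟩ : A.powerset)) ⁻¹' {⟨D, hD⟩}
  obtain ⟨n₁, hn₁⟩ := hinf.nonempty
  obtain ⟨n₂, hn₂, hlt⟩ := hinf.exists_gt n₁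
  have hDli : LinearIndepOn ℝ id (D : Set V) := hmem _ hn₁ ▸ hli n₁
  have hDmem : ∀ n ∈ T, v + ((n : ℝ) + 1)⁻¹ • w ∈ PointedCone.hull ℝ (D : Set V) :=
    fun n hn => hmem n hn ▸ hB n
  have hw : w ∈ Submodule.span ℝ (D : Set V) := by
    have h1 := PointedCone.hull_le_span ℝ (D : Set V) (hDmem _ hn₁)
    have h2 := PointedCone.hull_le_span ℝ (D : Set V) (hDmem _ hn₂)
    have h3 : ((n₁ : ℝ) + 1)⁻¹ - ((n₂ : ℝ) + 1)⁻¹ ≠ 0 := by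
      rw [sub_ne_zero]
      intro he
      have := inv_injective he
      have : (n₁ : ℝ) = n₂ := by linarith
      exact hlt.ne (by exact_mod_cast this)
    have h4 : (((n₁ : ℝ) + 1)⁻¹ - ((n₂ : ℝ) + 1)⁻¹) • w ∈ Submodule.span ℝ (D : Set V) := by
      have : (((n₁ : ℝ) + 1)⁻¹ - ((n₂ : ℝ) + 1)⁻¹) • w =
        (v + ((n₁ : ℝ) + 1)⁻¹ • w) - (v + ((n₂ : ℝ) + 1)⁻¹ • w) := by module
      rw [this]
      exact sub_mem (S := Submodule ℝ V) h1 h2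
    exact (Submodule.smul_mem_iff _ h3).1 h4
  have hv : v ∈ Submodule.span ℝ (D : Set V) := by
    have h1 := PointedCone.hull_le_span ℝ (D : Set V) (hDmem _ hn₁)
    have : v = (v + ((n₁ : ℝ) + 1)⁻¹ • w) - ((n₁ : ℝ) + 1)⁻¹ • w := by abel
    rw [this]
    exact sub_mem (S := Submodule ℝ V) h1 (Submodule.smul_mem _ _ hw)
  obtain ⟨α, -, hα⟩ := Submodule.mem_span_finset.1 hv
  obtain ⟨β, -, hβ⟩ := Submodule.mem_span_finset.1 hw
  have hnn : ∀ b ∈ D, 0 ≤ α b := by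
    intro b hb
    by_contra! hneg
    obtain ⟨N, hN⟩ := exists_nat_gt (β b / -α b)
    obtain ⟨n, hn, hNn⟩ := hinf.exists_gt N
    obtain ⟨c, hc, hcx⟩ := mem_hull_finset_iff.1 (hDmem n hn)
    have hz : ∑ a ∈ D, (α a + ((n : ℝ) + 1)⁻¹ * β a - c a) • id a = 0 := by
      simp only [sub_smul, add_smul, mul_smul, Finset.sum_sub_distrib, Finset.sum_add_distrib,
        ← Finset.smul_sum, id, hα, hβ, hcx, sub_self]
    have h1 := (linearIndepOn_finset_iff.1 hDli) _ hz b hb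
    have hn1 : (0 : ℝ) < n + 1 := by positivity
    have h2 : 0 ≤ α b + ((n : ℝ) + 1)⁻¹ * β b := by linarith [hc b]
    have h3 : 0 ≤ α b * (n + 1) + β b := by
      have := mul_nonneg h2 hn1.le
      rwa [add_mul, mul_right_comm, inv_mul_cancel₀ hn1.ne', one_mul] at this
    rw [div_lt_iff₀ (neg_pos.2 hneg)] at hN
    have : (N : ℝ) ≤ n := by exact_mod_cast hNn.le
    nlinarith
  have : v ∈ PointedCone.hull ℝ (D : Set V) := by
    rw [← hα]
    exact sum_mem fun a ha => PointedCone.smul_mem _ (hnn a ha) (PointedCone.subset_hull ha)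
  exact Submodule.span_mono (Finset.coe_subset.2 (Finset.mem_powerset.1 hD)) this

end Caratheodory

/-! ### From real to integral cone relations -/

section Rational

/-- There are `ℚ`-linear maps `ℝ → ℚ` which are positive on a given finite set of positive
reals. -/
theorem exists_linearMap_rat_pos (C : Finset ℝ) (hC : ∀ c ∈ C, 0 < c) :
    ∃ φ : ℝ →ₗ[ℚ] ℚ, ∀ c ∈ C, 0 < φ c := by
  classical
  let W := Submodule.span ℚ (C : Set ℝ)
  have : Module.Finite ℚ W := Module.Finite.span_finset ℚ C
  let b := Module.finBasis ℚ W
  have hCW : ∀ c : C, (c : ℝ) ∈ W := fun c => Submodule.subset_span c.2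
  let f : C → (Fin (Module.finrank ℚ W) → ℝ) → ℝ := fun c x =>
    ∑ i, ((b.repr ⟨c, hCW c⟩ i : ℚ) : ℝ) * x i
  have hopen : IsOpen {x | ∀ c, 0 < f c x} := by
    simp only [Set.ofPred_forall]
    refine isOpen_iInter_of_finite fun c => isOpen_lt continuous_const ?_
    fun_prop
  -- At the tuple of the basis elements themselves, f c takes the value c > 0. The set is open, so
  -- it also contains a rational tuple, which defines φ.
  have hne : ({x | ∀ c, 0 < f c x} : Set _).Nonempty := by
    refine ⟨fun i => (b i : ℝ), fun c => ?_⟩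
    have h1 : ((∑ i, b.repr ⟨c, hCW c⟩ i • b i : W) : ℝ) = c := by rw [b.sum_repr]
    have h2 : f c (fun i => (b i : ℝ)) = c := by
      refine Eq.trans ?_ h1
      simp only [f, AddSubmonoidClass.coe_finsetSum, Submodule.coe_smul, Rat.smul_def]
    rw [h2]
    exact hC c c.2
  have hd : DenseRange (Pi.map (fun _ : Fin (Module.finrank ℚ W) => ((↑) : ℚ → ℝ))) :=
    DenseRange.piMap fun _ => Rat.denseRange_cast
  obtain ⟨y, hy⟩ := hd.exists_mem_open hopen hne
  let ψ : W →ₗ[ℚ] ℚ := b.constr ℚ y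
  obtain ⟨φ, hφ⟩ := ψ.exists_extend
  refine ⟨φ, fun c hc => ?_⟩
  have h1 : φ c = ψ ⟨c, hCW ⟨c, hc⟩⟩ := by rw [← hφ]; rfl
  have h2 : ((ψ ⟨c, hCW ⟨c, hc⟩⟩ : ℚ) : ℝ) = f ⟨c, hc⟩ (Pi.map (fun _ => ((↑) : ℚ → ℝ)) y) := by
    simp [ψ, f, Module.Basis.constr_apply_fintype, Module.Basis.equivFun_apply]
  have h3 := hy ⟨c, hc⟩
  rw [h1]
  rw [← h2] at h3
  exact_mod_cast h3

variable {M : Type u} [AddCommGroup M]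

theorem toReal_zero : toReal (0 : M) = 0 := TensorProduct.tmul_zero _ _

theorem toReal_nsmul (n : ℕ) (m : M) : toReal (n • m) = (n : ℝ) • toReal m := by
  rw [toReal, ← TensorProduct.smul_tmul, ← TensorProduct.smul_tmul', Nat.cast_smul_eq_nsmul]
  rfl

theorem toReal_sub (a b : M) : toReal (a - b) = toReal a - toReal b :=
  TensorProduct.tmul_sub _ _ _

theorem coneOf_mono {S T : Set M} (h : S ⊆ T) : coneOf S ≤ coneOf T :=
  Submodule.span_mono (Set.image_mono h)

theorem exists_natCast_eq_mul (Q : Finset ℚ) :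
    ∃ D : ℕ, 0 < D ∧ ∀ q ∈ Q, 0 ≤ q → ∃ n : ℕ, (D : ℚ) * q = n := by
  classical
  refine ⟨∏ q ∈ Q, q.den, Finset.prod_pos fun q _ => q.den_pos, fun q hq h0 => ?_⟩
  refine ⟨(∏ p ∈ Q.erase q, p.den) * q.num.toNat, ?_⟩
  rw [← Finset.mul_prod_erase Q _ hq]
  have h1 : ((q.num.toNat : ℕ) : ℚ) = (q.num : ℚ) := by
    exact_mod_cast congrArg (Int.cast (R := ℚ)) (Int.toNat_of_nonneg (Rat.num_nonneg.2 h0))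
  push_cast
  rw [h1, mul_comm (q.den : ℚ), mul_assoc, Rat.den_mul_eq_num]

/-- A lattice point of the cone generated by a semigroup has a positive multiple in the
semigroup. -/
theorem exists_nsmul_mem_of_toReal_mem [Module.Free ℤ M] {S : AddSubmonoid M} {m : M}
    (h : toReal m ∈ coneOf (S : Set M)) : ∃ n : ℕ, 0 < n ∧ n • m ∈ S := by
  classical
  obtain ⟨t, htS, c, hc⟩ := (Submodule.mem_span_image_iff_exists_fun _).1 h
  -- A ℚ-linear map applied to the real coefficients of m turns the relation into one over ℚ. It is
  -- required to be positive only on 1 and on the positive coefficients, as zero goes to zero.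
  obtain ⟨φ, hφ⟩ := exists_linearMap_rat_pos
    (insert 1 ((Finset.univ.image fun i => (c i : ℝ)).filter (0 < ·))) (by
      intro x hx
      rcases Finset.mem_insert.1 hx with rfl | hx
      · exact one_pos
      · exact (Finset.mem_filter.1 hx).2)
  have h1 : 0 < φ 1 := hφ 1 (Finset.mem_insert_self _ _)
  have hci : ∀ i, 0 ≤ φ (c i) := by
    intro i
    rcases (c i).2.eq_or_lt with h0 | h0
    · rw [← h0, map_zero]
    · exact (hφ _ (Finset.mem_insert_of_mem (Finset.mem_filter.2
        ⟨Finset.mem_image_of_mem _ (Finset.mem_univ i), h0⟩))).le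
  obtain ⟨D, hD, hDq⟩ := exists_natCast_eq_mul (insert (φ 1) (Finset.univ.image fun i => φ (c i)))
  obtain ⟨n, hn⟩ := hDq _ (Finset.mem_insert_self _ _) h1.le
  choose k hk using fun i => hDq (φ (c i))
    (Finset.mem_insert_of_mem (Finset.mem_image_of_mem _ (Finset.mem_univ i))) (hci i)
  have hn0 : 0 < n := by
    have : (0 : ℚ) < n := by rw [← hn]; positivity
    exact_mod_cast this
  -- M is free, hence flat, so a relation in ℚ ⊗ M with denominators cleared already holds in M.
  have hinj : Function.Injective fun x : M => (1 : ℚ) ⊗ₜ[ℤ] x := by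
    have hj := Module.Flat.rTensor_preserves_injective_linearMap (M := M)
      (Algebra.linearMap ℤ ℚ) (Int.cast_injective)
    intro x y hxy
    have : (1 : ℤ) ⊗ₜ[ℤ] x = (1 : ℤ) ⊗ₜ[ℤ] y := hj (by simpa using hxy)
    simpa using congrArg (TensorProduct.lid ℤ M) this
  have hnat : ∀ (a : ℕ) (x : M), (a : ℚ) ⊗ₜ[ℤ] x = (1 : ℚ) ⊗ₜ[ℤ] (a • x) := by
    intro a x
    rw [← TensorProduct.smul_tmul, nsmul_one]
  have key : n • m = ∑ i, k i • (i : M) := by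
    refine hinj ?_
    have h3 : ∀ i, c i • toReal (i : M) = ((c i : ℝ) ⊗ₜ[ℤ] (i : M) : RealSpace M) := by
      intro i
      change (c i : ℝ) • ((1 : ℝ) ⊗ₜ[ℤ] (i : M)) = _
      rw [TensorProduct.smul_tmul', smul_eq_mul, mul_one]
    rw [Finset.sum_congr rfl fun i _ => h3 i] at hc
    have h2 := congrArg (LinearMap.rTensor M
      (((D : ℚ) • φ).toAddMonoidHom.toIntLinearMap)) hc
    simp only [map_sum, toReal, LinearMap.rTensor_tmul, AddMonoidHom.coe_toIntLinearMap,
      LinearMap.toAddMonoidHom_coe, LinearMap.smul_apply, smul_eq_mul, hk, hn, hnat] at h2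
    change (1 : ℚ) ⊗ₜ[ℤ] (n • m) = (1 : ℚ) ⊗ₜ[ℤ] (∑ i, k i • (i : M))
    rw [TensorProduct.tmul_sum]
    exact h2.symm
  exact ⟨n, hn0, key ▸ sum_mem fun i _ => nsmul_mem (htS i.2) _⟩

end Rational

/-! ### Codimension one faces -/

section Codim

variable {M : Type u} [AddCommGroup M]

theorem IsCodimOneFace.ne {τ F : Cone M} (h : IsCodimOneFace τ F) : τ ≠ F := by
  rintro rfl
  exact absurd h.2 (Nat.succ_ne_self _)

theorem IsCodimOneFace.exists_notMem {τ F : Cone M} (h : IsCodimOneFace τ F) :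
    ∃ t ∈ F, t ∉ τ := by
  by_contra! hc
  exact h.ne (le_antisymm h.1.le hc)

theorem IsRationalPolyhedral.exists_finset {σ : Cone M} (h : IsRationalPolyhedral σ) :
    ∃ A : Finset (RealSpace M), σ = PointedCone.hull ℝ (A : Set (RealSpace M)) := by
  classical
  obtain ⟨A, rfl⟩ := h
  exact ⟨A.image toReal, by rw [Finset.coe_image]; rfl⟩

theorem IsRationalPolyhedral.exists_isOrderUnit {σ : Cone M} (h : IsRationalPolyhedral σ) :
    ∃ u, IsOrderUnit σ u := by
  obtain ⟨A, rfl⟩ := h.exists_finset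
  exact ⟨_, exists_isOrderUnit_hull A⟩

variable [Module.Finite ℤ M]

theorem coneDim_lt_of_face {τ F : Cone M} (h : τ.IsFaceOf F) (hne : τ ≠ F) :
    coneDim τ < coneDim F :=
  Submodule.finrank_lt_finrank_of_lt (span_lt_span_of_face h hne)

/-- Adding t to span τ raises the dimension, so span τ + ℝ t already has the dimension of span F. -/
theorem IsCodimOneFace.mem_span_sup {τ F : Cone M} (h : IsCodimOneFace τ F) {t : RealSpace M}
    (ht : t ∈ F) (htτ : t ∉ τ) {a : RealSpace M} (ha : a ∈ F) :
    ∃ p ∈ Submodule.span ℝ (τ : Set (RealSpace M)), ∃ c : ℝ, p + c • t = a := by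
  set W := Submodule.span ℝ (τ : Set (RealSpace M)) ⊔ Submodule.span ℝ {t} with hW
  have htW : t ∈ W := (le_sup_right : _ ≤ W) (Submodule.mem_span_singleton_self t)
  have hle : W ≤ Submodule.span ℝ (F : Set (RealSpace M)) :=
    sup_le (Submodule.span_mono h.1.le)
      (Submodule.span_le.2 (Set.singleton_subset_iff.2 (Submodule.subset_span ht)))
  have hlt : Submodule.span ℝ (τ : Set (RealSpace M)) < W := by
    refine lt_of_le_of_ne le_sup_left fun he => htτ (mem_face_of_mem_span h.1 ht ?_)
    rw [he]
    exact htW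
  have h1 := Submodule.finrank_lt_finrank_of_lt hlt
  have h2 : W = Submodule.span ℝ (F : Set (RealSpace M)) :=
    Submodule.eq_of_le_of_finrank_le hle (by
      have := h.2
      unfold coneDim at this
      omega)
  have haW : a ∈ W := h2 ▸ Submodule.subset_span ha
  obtain ⟨p, hp, y, hy, rfl⟩ := Submodule.mem_sup.1 haW
  obtain ⟨c, rfl⟩ := Submodule.mem_span_singleton.1 hy
  exact ⟨p, hp, c, rfl⟩

theorem IsCodimOneFace.eq_or_eq {τ ρ F : Cone M} (h : IsCodimOneFace τ F) (hρ : ρ.IsFaceOf F)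
    (hle : τ ≤ ρ) : ρ = τ ∨ ρ = F := by
  by_cases hne : ρ = F
  · exact Or.inr hne
  refine Or.inl (le_antisymm (fun a ha => ?_) hle)
  have h1 := coneDim_lt_of_face hρ hne
  have h2 : Submodule.span ℝ (τ : Set (RealSpace M)) = Submodule.span ℝ (ρ : Set (RealSpace M)) :=
    Submodule.eq_of_le_of_finrank_le (Submodule.span_mono hle) (by
      have := h.2
      unfold coneDim at *
      omega)
  exact mem_face_of_mem_span h.1 (hρ.le ha) (h2 ▸ Submodule.subset_span ha)

/-- By `exists_le_span_sup_of_maximal`, span F exceeds span τ by at most one dimension. -/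
theorem isCodimOneFace_of_maximal {τ F : Cone M} (hF : IsRationalPolyhedral F)
    (hτ : IsRationalPolyhedral τ) (h : τ.IsFaceOf F) (hne : τ ≠ F)
    (hmax : ∀ ρ : Cone M, ρ.IsFaceOf F → τ ≤ ρ → ρ = τ ∨ ρ = F) : IsCodimOneFace τ F := by
  obtain ⟨u, hu⟩ := hτ.exists_isOrderUnit
  refine ⟨h, le_antisymm (coneDim_lt_of_face h hne) ?_⟩
  obtain ⟨A, rfl⟩ := hF.exists_finset
  obtain ⟨s, -, hs⟩ := exists_le_span_sup_of_maximal A.finite_toSet h hne hu hmax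
  have hle : Submodule.span ℝ (PointedCone.hull ℝ (A : Set (RealSpace M)) : Set (RealSpace M)) ≤
      Submodule.span ℝ (τ : Set (RealSpace M)) ⊔ Submodule.span ℝ {s} := by
    rw [Submodule.span_le]
    exact (Submodule.span_le.2 hs : PointedCone.hull ℝ (A : Set (RealSpace M)) ≤
      PointedCone.ofSubmodule (Submodule.span ℝ (τ : Set (RealSpace M)) ⊔ Submodule.span ℝ {s}))
  refine (Submodule.finrank_mono hle).trans
    ((Submodule.finrank_add_le_finrank_add_finrank _ _).trans ?_)
  exact Nat.add_le_add_left ((finrank_span_le_card _).trans (by simp)) _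

/-- A codimension one face is cut out by a linear functional. -/
theorem IsCodimOneFace.exists_functional {τ F : Cone M} (h : IsCodimOneFace τ F) :
    ∃ f : RealSpace M →ₗ[ℝ] ℝ, (∀ a ∈ F, 0 ≤ f a) ∧ (∀ a ∈ τ, f a = 0) ∧
      ∀ a ∈ F, f a = 0 → a ∈ τ := by
  obtain ⟨t, ht, htτ⟩ := h.exists_notMem
  -- After division by g t, the functional reads off the coefficient c in a = p + c t with p ∈ span
  -- τ. If c < 0, then a + (-c) t lies in τ, and the face property would put t in τ.
  obtain ⟨g, hgt, hg⟩ := Submodule.exists_le_ker_of_notMem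
    (fun hs => htτ (mem_face_of_mem_span h.1 ht hs))
  have hval : ∀ p ∈ Submodule.span ℝ (τ : Set (RealSpace M)), ∀ c : ℝ,
      ((g t)⁻¹ • g) (p + c • t) = c := by
    intro p hp c
    have : g p = 0 := hg hp
    rw [LinearMap.smul_apply, map_add, this, zero_add, map_smul, smul_eq_mul, smul_eq_mul]
    field_simp
  refine ⟨(g t)⁻¹ • g, fun a ha => ?_, fun a ha => ?_, fun a ha h0 => ?_⟩
  · obtain ⟨p, hp, c, rfl⟩ := h.mem_span_sup ht htτ ha
    rw [hval p hp c]
    by_contra! hc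
    have hmem : (p + c • t) + (-c) • t ∈ τ := by
      refine mem_face_of_mem_span h.1
        (add_mem ha (PointedCone.smul_mem F (neg_nonneg.2 hc.le) ht)) ?_
      simpa using hp
    exact htτ (h.1.mem_of_smul_add_mem ht ha (neg_pos.2 hc) (by rwa [add_comm]))
  · have := hval a (Submodule.subset_span ha) 0
    simpa using this
  · obtain ⟨p, hp, c, rfl⟩ := h.mem_span_sup ht htτ ha
    rw [hval p hp c] at h0
    refine mem_face_of_mem_span h.1 ha ?_
    simpa [h0] using hp

end Codim

/-! ### Cones of a fan and the half-spaces of their codimension one faces -/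

namespace Fan

variable {M : Type u} [AddCommGroup M] (Δ : Fan M) {σ τ F : Cone M}

theorem exists_isOrderUnit (hσ : σ ∈ Δ.cones) : ∃ u, IsOrderUnit σ u :=
  (Δ.rational σ hσ).exists_isOrderUnit

variable {Δ} in
theorem isFaceOf_of_le (hσ : σ ∈ Δ.cones) (hτ : τ ∈ Δ.cones) (h : σ ≤ τ) : σ.IsFaceOf τ := by
  have := (Δ.inter_face σ hσ τ hτ).2
  rwa [inf_eq_left.2 h] at this

variable {Δ} in
theorem inf_mem (hσ : σ ∈ Δ.cones) (hτ : τ ∈ Δ.cones) : σ ⊓ τ ∈ Δ.cones :=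
  Δ.face_mem σ hσ _ (Δ.inter_face σ hσ τ hτ).1

theorem exists_facet_ge (hσ : σ ∈ Δ.cones) : ∃ F, Δ.IsFacet F ∧ σ ≤ F := by
  obtain ⟨F, hle, hF⟩ := Δ.finite.exists_le_maximal hσ
  exact ⟨F, hF, hle⟩

variable {Δ} in
theorem IsFacet.mem (hF : Δ.IsFacet F) : F ∈ Δ.cones := hF.prop

variable {Δ} in
theorem IsFacet.eq_of_le (hF : Δ.IsFacet F) (hσ : σ ∈ Δ.cones) (h : F ≤ σ) : F = σ :=
  le_antisymm h (hF.2 hσ h)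

variable [Module.Finite ℤ M]

/-- Every proper face is contained in a face of codimension one. -/
theorem exists_isCodimOneFace_ge (hF : F ∈ Δ.cones) (h : σ.IsFaceOf F) (hne : σ ≠ F) :
    ∃ τ, IsCodimOneFace τ F ∧ σ ≤ τ := by
  have hfin : {τ : Cone M | τ.IsFaceOf F ∧ τ ≠ F}.Finite :=
    Δ.finite.subset fun τ hτ => Δ.face_mem F hF τ hτ.1
  obtain ⟨τ, hle, hτ⟩ := hfin.exists_le_maximal (a := σ) ⟨h, hne⟩
  refine ⟨τ, isCodimOneFace_of_maximal (Δ.rational F hF)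
    (Δ.rational τ (Δ.face_mem F hF τ hτ.prop.1)) hτ.prop.1 hτ.prop.2 fun ρ hρ hτρ => ?_, hle⟩
  by_cases he : ρ = F
  · exact Or.inr he
  · exact Or.inl (le_antisymm (hτ.2 ⟨hρ, he⟩ hτρ) hτρ)

/-- A cone is the intersection of its linear span with the half-spaces given by its codimension
one faces. -/
theorem mem_of_forall_isCodimOneFace (hF : F ∈ Δ.cones) {v : RealSpace M}
    (hspan : ∃ s ∈ F, ∃ t ∈ F, v = s - t)
    (h : ∀ τ, IsCodimOneFace τ F → ∃ s ∈ F, ∃ t ∈ τ, v = s - t) : v ∈ F := by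
  obtain ⟨u, hu⟩ := Δ.exists_isOrderUnit hF
  obtain ⟨s, hs, t, ht, hst⟩ := hspan
  obtain ⟨N, hN⟩ := hu.2 t ht
  -- Move v along the interior direction u until it enters F. If the infimum l₀ is positive, the
  -- entry point is in a proper face, hence in a codimension one face τ. Its functional f vanishes
  -- there although f v ≥ 0 and f u > 0.
  set Λ : Set ℝ := {l | 0 ≤ l ∧ v + l • u ∈ F} with hΛ
  have hne : Λ.Nonempty := by
    refine ⟨N, N.cast_nonneg, ?_⟩
    have : v + (N : ℝ) • u = s + ((N : ℝ) • u - t) := by rw [hst]; abel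
    rw [this]
    exact add_mem hs hN
  have hbdd : BddBelow Λ := ⟨0, fun l hl => hl.1⟩
  set l₀ := sInf Λ with hl₀
  have hl₀0 : 0 ≤ l₀ := le_csInf hne fun l hl => hl.1
  have hgt : ∀ l, l₀ < l → v + l • u ∈ F := by
    intro l hl
    obtain ⟨l', hl', hlt⟩ := exists_lt_of_csInf_lt hne hl
    have : v + l • u = (v + l' • u) + (l - l') • u := by module
    rw [this]
    exact add_mem hl'.2 (PointedCone.smul_mem F (sub_nonneg.2 hlt.le) hu.1)
  have hb : v + l₀ • u ∈ F := by
    obtain ⟨A, hA⟩ := (Δ.rational F hF).exists_finset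
    rw [hA]
    refine mem_hull_of_forall_add_smul_mem (w := u) fun n => ?_
    have h1 := hgt (l₀ + ((n : ℝ) + 1)⁻¹) (lt_add_of_pos_right _ (by positivity))
    rw [← hA, add_assoc, ← add_smul]
    exact h1
  rcases hl₀0.eq_or_lt with h0 | h0
  · simpa [← h0] using hb
  exfalso
  have hproper : minFace F (v + l₀ • u) ≠ F := by
    intro he
    have hmem : u ∈ minFace F (v + l₀ • u) := by rw [he]; exact hu.1
    obtain ⟨-, K, hK⟩ := hmem
    have hK1 : ((K : ℝ) + 1) • (v + l₀ • u) - u ∈ F := by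
      have : ((K : ℝ) + 1) • (v + l₀ • u) - u =
        ((K : ℝ) • (v + l₀ • u) - u) + (v + l₀ • u) := by module
      rw [this]
      exact add_mem hK hb
    have hKpos : (0 : ℝ) < K + 1 := by positivity
    -- If the entry point were interior, one could step back by 1/(K+1). The truncation at 0 keeps
    -- the new parameter in Λ.
    set l₁ := max 0 (l₀ - ((K : ℝ) + 1)⁻¹) with hl₁
    have hlt : l₁ < l₀ := max_lt h0 (sub_lt_self _ (by positivity))
    have hmem : v + l₁ • u ∈ F := by
      have h1 := PointedCone.smul_mem F (inv_nonneg.2 hKpos.le) hK1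
      rw [smul_sub, smul_smul, inv_mul_cancel₀ hKpos.ne', one_smul] at h1
      have : v + l₁ • u = (v + l₀ • u - ((K : ℝ) + 1)⁻¹ • u) +
        (l₁ - (l₀ - ((K : ℝ) + 1)⁻¹)) • u := by module
      rw [this]
      exact add_mem h1 (PointedCone.smul_mem F (sub_nonneg.2 (le_max_right _ _)) hu.1)
    exact absurd (csInf_le hbdd ⟨le_max_left _ _, hmem⟩) (not_le.2 hlt)
  obtain ⟨τ, hτ, hle⟩ := Δ.exists_isCodimOneFace_ge hF (minFace_isFaceOf F _) hproper
  obtain ⟨f, hf0, hfτ, hfF⟩ := hτ.exists_functional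
  have hfb : f (v + l₀ • u) = 0 := hfτ _ (hle (self_mem_minFace hb))
  have hfu : 0 < f u := (hf0 u hu.1).lt_of_ne fun h0 =>
    hτ.ne (le_antisymm hτ.1.le (hu.le_of_mem hτ.1 le_rfl (hfF u hu.1 h0.symm)))
  obtain ⟨s', hs', t', ht', hv⟩ := h τ hτ
  have hfv : 0 ≤ f v := by
    rw [hv, map_sub, hfτ t' ht', sub_zero]
    exact hf0 s' hs'
  rw [map_add, map_smul, smul_eq_mul] at hfb
  nlinarith [mul_pos h0 hfu]

end Fan

/-! ### Depth at least two as a divisibility criterion -/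

section Depth

theorem length_le_localDepth {A : Type u} [CommRing A] [IsLocalRing A] {rs : List A}
    (hm : ∀ r ∈ rs, r ∈ IsLocalRing.maximalIdeal A)
    (hr : RingTheory.Sequence.IsWeaklyRegular A rs) : (rs.length : ℕ∞) ≤ localDepth A :=
  le_iSup₂_of_le rs
    ⟨hm, (IsLocalRing.isRegular_iff_isWeaklyRegular_of_subset_maximalIdeal hm).2 hr⟩ le_rfl

theorem isSMulRegular_quotSMulTop_iff {A : Type u} [CommRing A] (x y : A) :
    IsSMulRegular (QuotSMulTop x A) y ↔ ∀ w : A, x ∣ y * w → x ∣ w := by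
  rw [isSMulRegular_quotient_iff_mem_of_smul_mem]
  simp [Submodule.mem_smul_pointwise_iff_exists, dvd_def, eq_comm]

theorem isSMulRegular_self_iff {A : Type u} [CommRing A] {x : A} :
    IsSMulRegular A x ↔ x ∈ nonZeroDivisors A := by
  rw [isSMulRegular_iff_right_eq_zero_of_smul, mem_nonZeroDivisors_iff]
  simp [mul_comm]

theorem one_le_localDepth {A : Type u} [CommRing A] [IsLocalRing A] {x : A}
    (hx : x ∈ IsLocalRing.maximalIdeal A) (hreg : x ∈ nonZeroDivisors A) :
    1 ≤ localDepth A := by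
  have := length_le_localDepth (rs := [x]) (by simpa using hx)
    ((RingTheory.Sequence.isWeaklyRegular_singleton_iff A x).2
      ((isSMulRegular_self_iff).2 hreg))
  simpa using this

theorem two_le_localDepth_iff {A : Type u} [CommRing A] [IsLocalRing A] :
    2 ≤ localDepth A ↔ ∃ x ∈ IsLocalRing.maximalIdeal A, ∃ y ∈ IsLocalRing.maximalIdeal A,
      x ∈ nonZeroDivisors A ∧ ∀ w : A, x ∣ y * w → x ∣ w := by
  constructor
  · intro h
    have h1 : (1 : ℕ∞) < localDepth A := lt_of_lt_of_le (by norm_num) h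
    obtain ⟨rs, h2⟩ := lt_iSup_iff.1 h1
    obtain ⟨⟨hm, hr⟩, h3⟩ := lt_iSup_iff.1 h2
    match rs, hm, hr, h3 with
    | [], _, _, h3 => simp at h3
    | [x], _, _, h3 => simp at h3
    | x :: y :: rs, hm, hr, _ =>
      have hw := hr.toIsWeaklyRegular
      rw [RingTheory.Sequence.isWeaklyRegular_cons_iff,
        RingTheory.Sequence.isWeaklyRegular_cons_iff] at hw
      exact ⟨x, hm x (by simp), y, hm y (by simp),
        isSMulRegular_self_iff.1 hw.1,
        (isSMulRegular_quotSMulTop_iff x y).1 hw.2.1⟩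
  · rintro ⟨x, hx, y, hy, hxr, hyr⟩
    have := length_le_localDepth (rs := [x, y]) (fun r hr => by
      rcases List.mem_pair.1 hr with rfl | rfl <;> assumption) (by
      rw [RingTheory.Sequence.isWeaklyRegular_cons_iff,
        RingTheory.Sequence.isWeaklyRegular_singleton_iff]
      exact ⟨isSMulRegular_self_iff.2 hxr,
        (isSMulRegular_quotSMulTop_iff x y).2 hyr⟩)
    simpa using this

/-- In a local ring of depth at least two, divisibility by a nonzerodivisor can be tested after
multiplication with the maximal ideal. -/
theorem dvd_of_two_le_localDepth {A : Type u} [CommRing A] [IsLocalRing A]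
    (h : 2 ≤ localDepth A) {x w : A} (hx : x ∈ nonZeroDivisors A)
    (hw : ∀ a ∈ IsLocalRing.maximalIdeal A, x ∣ a * w) : x ∣ w := by
  obtain ⟨a, ha, b, hb, har, hbr⟩ := two_le_localDepth_iff.1 h
  obtain ⟨c, hc⟩ := hw a ha
  obtain ⟨d, hd⟩ := hw b hb
  -- With aw = xc and bw = xd, regularity of b modulo a makes c = ae, and then w = xe.
  have h1 : b * c = a * d := by
    have : x * (b * c) = x * (a * d) := by
      calc x * (b * c) = b * (x * c) := by ring
        _ = a * (x * d) := by rw [← hc, ← hd]; ring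
        _ = _ := by ring
    exact (mul_cancel_left_mem_nonZeroDivisors hx).1 this
  obtain ⟨e, rfl⟩ := hbr c ⟨d, h1⟩
  refine ⟨e, (mul_cancel_left_mem_nonZeroDivisors har).1 ?_⟩
  rw [hc]; ring

/-- If divisibility by the nonzerodivisor `x` can be tested after multiplication with the maximal
ideal, then the depth is at least two. -/
theorem two_le_localDepth_of_dvd {A : Type u} [CommRing A] [IsLocalRing A] [IsNoetherianRing A]
    {x : A} (hxm : x ∈ IsLocalRing.maximalIdeal A) (hx : x ∈ nonZeroDivisors A)
    (h : ∀ w : A, (∀ a ∈ IsLocalRing.maximalIdeal A, x ∣ a * w) → x ∣ w) :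
    2 ≤ localDepth A := by
  rw [two_le_localDepth_iff]
  by_contra! hcon
  -- Otherwise the maximal ideal consists of zero divisors on A/x. Prime avoidance puts it in an
  -- associated prime, the annihilator of some nonzero class w, against the hypothesis on w.
  have hsub : ((IsLocalRing.maximalIdeal A : Ideal A) : Set A) ⊆
      ⋃ p ∈ associatedPrimes A (A ⧸ Ideal.span {x}), p := by
    rw [biUnion_associatedPrimes_eq_zero_divisors]
    intro y hy
    obtain ⟨w, hyw, hw⟩ := hcon x hxm y hy hx
    refine ⟨Ideal.Quotient.mk _ w, ?_, ?_⟩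
    · rwa [Ne, Ideal.Quotient.eq_zero_iff_dvd]
    · rw [Algebra.smul_def, Ideal.Quotient.algebraMap_eq, ← map_mul,
        Ideal.Quotient.eq_zero_iff_dvd]
      exact hyw
  obtain ⟨P, hP, hle⟩ := (Ideal.subset_union_prime_finite
    (associatedPrimes.finite A (A ⧸ Ideal.span {x})) (f := id) 0 0 fun _ h _ _ ↦ h.1).1 hsub
  obtain ⟨hPp, w, rfl⟩ := isAssociatedPrime_iff.1 hP
  obtain ⟨w, rfl⟩ := Ideal.Quotient.mk_surjective w
  have hw : ∀ a ∈ IsLocalRing.maximalIdeal A, x ∣ a * w := by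
    intro a ha
    have := hle ha
    rw [id, Submodule.mem_colon_singleton, Submodule.mem_bot, Algebra.smul_def,
      Ideal.Quotient.algebraMap_eq, ← map_mul, Ideal.Quotient.eq_zero_iff_dvd] at this
    exact this
  have := h w hw
  refine hPp.ne_top ((Ideal.eq_top_iff_one _).2 ?_)
  rw [Submodule.mem_colon_singleton, Submodule.mem_bot, one_smul,
    Ideal.Quotient.eq_zero_iff_dvd]
  exact this

end Depth

/-! ### Serre's property S₂ as divisibility in codimension one -/

section Serre

variable {R : Type u} [CommRing R]

/-- Divisibility by nonzerodivisors can be tested in codimension one. -/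
def DvdInCodimOne (R : Type u) [CommRing R] : Prop :=
  ∀ x ∈ nonZeroDivisors R, ∀ w : R,
    (∀ q : Ideal R, q.IsPrime → q.height ≤ 1 → ∃ i ∉ q, x ∣ i * w) → x ∣ w

theorem exists_dvd_mul_of_algebraMap_dvd {p : Ideal R} [p.IsPrime] {A : Type u} [CommRing A]
    [Algebra R A] [IsLocalization.AtPrime A p] {x w : R}
    (h : algebraMap R A x ∣ algebraMap R A w) : ∃ s ∉ p, x ∣ s * w := by
  obtain ⟨c, hc⟩ := h
  obtain ⟨⟨r, s⟩, hs⟩ := IsLocalization.surj p.primeCompl c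
  have h1 : algebraMap R A (s * w) = algebraMap R A (x * r) := by
    rw [map_mul, map_mul, hc, ← hs]; ring
  obtain ⟨t, ht⟩ := (IsLocalization.eq_iff_exists p.primeCompl A).1 h1
  refine ⟨t * s, (t * s).2, t * r, ?_⟩
  rw [mul_assoc, ht]; ring

theorem algebraMap_dvd_of_dvd_mul {p : Ideal R} [p.IsPrime] {A : Type u} [CommRing A]
    [Algebra R A] [IsLocalization.AtPrime A p] {x w s : R} (hs : s ∉ p)
    (h : x ∣ s * w) : algebraMap R A x ∣ algebraMap R A w := by
  have h1 := map_dvd (algebraMap R A) h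
  rw [map_mul] at h1
  exact ((IsLocalization.map_units A (⟨s, hs⟩ : p.primeCompl)).dvd_mul_left).1 h1

theorem algebraMap_mem_nonZeroDivisors {p : Ideal R} [p.IsPrime] (A : Type u) [CommRing A]
    [Algebra R A] [IsLocalization.AtPrime A p] {x : R} (hx : x ∈ nonZeroDivisors R) :
    algebraMap R A x ∈ nonZeroDivisors A :=
  IsLocalization.map_nonZeroDivisors_le p.primeCompl A (Submonoid.mem_map_of_mem _ hx)

/-- If x does not divide w, the annihilator of w in R/x lies in an associated prime P, the
annihilator of a class v. The hypothesis on w excludes height at most one. At height at least two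
the depth of R_P makes x divide v in R_P, so an element outside P annihilates v. -/
theorem dvdInCodimOne_of_depth [IsNoetherianRing R]
    (h : ∀ (p : Ideal R) [p.IsPrime], 2 ≤ p.height → ∃ (A : Type u) (_ : CommRing A)
      (_ : IsLocalRing A) (_ : Algebra R A), IsLocalization.AtPrime A p ∧ 2 ≤ localDepth A) :
    DvdInCodimOne R := by
  intro x hx w hw
  by_contra hxw
  have hw0 : (Ideal.Quotient.mk (Ideal.span {x}) w) ≠ 0 := by
    rwa [Ne, Ideal.Quotient.eq_zero_iff_dvd]
  have hcol : ∀ a v : R, a ∈ (⊥ : Submodule R (R ⧸ Ideal.span {x})).colon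
      {Ideal.Quotient.mk (Ideal.span {x}) v} ↔ x ∣ a * v := by
    intro a v
    rw [Submodule.mem_colon_singleton, Submodule.mem_bot, Algebra.smul_def,
      Ideal.Quotient.algebraMap_eq, ← map_mul, Ideal.Quotient.eq_zero_iff_dvd]
  obtain ⟨P, hP, hle⟩ := exists_le_isAssociatedPrime_of_isNoetherianRing R _ hw0
  obtain ⟨hPp, v, hv⟩ := isAssociatedPrime_iff.1 hP
  obtain ⟨v, rfl⟩ := Ideal.Quotient.mk_surjective v
  have hht : 2 ≤ P.height := by
    by_contra! hlt
    obtain ⟨i, hi, hiw⟩ := hw P hPp (by simpa using hlt)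
    exact hi (hle ((hcol i w).2 hiw))
  obtain ⟨A, _, _, _, hA, hdepth⟩ := h P hht
  have h1 : algebraMap R A x ∣ algebraMap R A v := by
    refine dvd_of_two_le_localDepth hdepth (algebraMap_mem_nonZeroDivisors (p := P) A hx)
      fun a ha => ?_
    obtain ⟨⟨r, s⟩, hs⟩ := IsLocalization.surj P.primeCompl a
    have hr : r ∈ P := by
      rw [← IsLocalization.AtPrime.to_map_mem_maximal_iff A P, ← hs]
      exact Ideal.mul_mem_right _ _ ha
    rw [hv, hcol] at hr
    have h2 := map_dvd (algebraMap R A) hr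
    rw [map_mul, ← hs, mul_comm a, mul_assoc] at h2
    exact ((IsLocalization.map_units A s).dvd_mul_left).1 h2
  obtain ⟨s, hs, hsv⟩ := exists_dvd_mul_of_algebraMap_dvd (p := P) h1
  rw [← hcol, ← hv] at hsv
  exact hs hsv

/-- No prime of height at most one contains p, so an element v with x ∣ i v for all i ∈ p satisfies
the codimension one test. Finite generation of p clears all denominators at once. -/
theorem DvdInCodimOne.two_le_localDepth [IsNoetherianRing R] (h : DvdInCodimOne R)
    {p : Ideal R} [p.IsPrime] (hp : 2 ≤ p.height) (A : Type u) [CommRing A] [IsLocalRing A]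
    [Algebra R A] [IsLocalization.AtPrime A p] {x : R} (hxp : x ∈ p)
    (hx : x ∈ nonZeroDivisors R) : 2 ≤ localDepth A := by
  have : IsNoetherianRing A := IsLocalization.isNoetherianRing p.primeCompl A ‹_›
  refine two_le_localDepth_of_dvd (x := algebraMap R A x)
    ((IsLocalization.AtPrime.to_map_mem_maximal_iff A p x).2 hxp)
    (algebraMap_mem_nonZeroDivisors (p := p) A hx) fun w hw => ?_
  obtain ⟨⟨v, s⟩, hs⟩ := IsLocalization.surj p.primeCompl w
  obtain ⟨T, hT⟩ := (isNoetherianRing_iff_ideal_fg R).1 ‹_› p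
  have hex : ∀ i : T, ∃ t ∉ p, x ∣ t * ((i : R) * v) := by
    intro i
    refine exists_dvd_mul_of_algebraMap_dvd (A := A) (p := p) ?_
    have hi : (i : R) ∈ p := hT ▸ Ideal.subset_span i.2
    have h1 := hw _ ((IsLocalization.AtPrime.to_map_mem_maximal_iff A p (i : R)).2 hi)
    rw [map_mul, ← hs, ← mul_assoc]
    exact h1.mul_right _
  choose t htp htx using hex
  have hprod : ∏ i, t i ∉ p := by
    rw [Ideal.IsPrime.prod_mem_iff]
    rintro ⟨i, -, hi⟩
    exact htp i hi
  have hall : ∀ i ∈ p, x ∣ i * ((∏ i, t i) * v) := by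
    have hle : p ≤ ((Ideal.span {x}).colon {(∏ i, t i) * v} : Ideal R) := by
      conv_lhs => rw [← hT]
      refine Ideal.span_le.2 fun i hi => ?_
      rw [SetLike.mem_coe, Submodule.mem_colon_singleton, smul_eq_mul, Ideal.mem_span_singleton]
      have h2 : t ⟨i, hi⟩ ∣ ∏ i, t i := Finset.dvd_prod_of_mem _ (Finset.mem_univ _)
      obtain ⟨c, hc⟩ := h2
      obtain ⟨d, hd⟩ := htx ⟨i, hi⟩
      exact ⟨c * d, by rw [hc]; linear_combination c * hd⟩
    intro i hi
    have := hle hi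
    rwa [Submodule.mem_colon_singleton, smul_eq_mul, Ideal.mem_span_singleton] at this
  have hdvd : x ∣ (∏ i, t i) * v := by
    refine h x hx _ fun q hq hq1 => ?_
    have : ¬ p ≤ q := fun hle => by
      have := hp.trans ((Ideal.height_mono hle).trans hq1)
      exact absurd this (by norm_num)
    obtain ⟨i, hi, hiq⟩ := SetLike.not_le_iff_exists.1 this
    exact ⟨i, hiq, hall i hi⟩
  have h3 := algebraMap_dvd_of_dvd_mul (A := A) hprod hdvd
  rw [← hs] at h3
  exact ((IsLocalization.map_units A s).dvd_mul_right).1 h3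

/-- A characterization of Serre's property `S₂` for Noetherian rings in which every non-minimal
prime ideal contains a nonzerodivisor. -/
theorem satisfiesSerre_two_iff [IsNoetherianRing R]
    (hnz : ∀ p : Ideal R, p.IsPrime → p.height ≠ 0 → ∃ x ∈ p, x ∈ nonZeroDivisors R) :
    SatisfiesSerre (AlgebraicGeometry.Spec (CommRingCat.of R)) 2 ↔ DvdInCodimOne R := by
  let X := AlgebraicGeometry.Spec (CommRingCat.of R)
  have hloc : ∀ x : X, ∃ (p : Ideal R) (_ : p.IsPrime) (_ : Algebra R (X.presheaf.stalk x)),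
      IsLocalization.AtPrime (X.presheaf.stalk x) p := fun x =>
    ⟨PrimeSpectrum.asIdeal x, PrimeSpectrum.isPrime x,
      AlgebraicGeometry.StructureSheaf.stalkAlgebra R x,
      AlgebraicGeometry.StructureSheaf.IsLocalization.to_stalk R x⟩
  have hpt : ∀ (p : Ideal R) [p.IsPrime], ∃ (x : X) (_ : Algebra R (X.presheaf.stalk x)),
      IsLocalization.AtPrime (X.presheaf.stalk x) p := fun p hp =>
    ⟨(⟨p, hp⟩ : PrimeSpectrum R),
      AlgebraicGeometry.StructureSheaf.stalkAlgebra R (⟨p, hp⟩ : PrimeSpectrum R),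
      AlgebraicGeometry.StructureSheaf.IsLocalization.to_stalk R (⟨p, hp⟩ : PrimeSpectrum R)⟩
  constructor
  · intro h
    refine dvdInCodimOne_of_depth fun p hp hht => ?_
    obtain ⟨x, halg, hA⟩ := hpt p
    refine ⟨_, inferInstance, inferInstance, halg, hA, ?_⟩
    have h1 := h x
    rw [IsLocalization.AtPrime.ringKrullDim_eq_height p] at h1
    change min ((2 : ℕ∞) : WithBot ℕ∞) _ ≤ _ at h1
    rw [min_eq_left (WithBot.coe_le_coe.2 hht)] at h1
    exact WithBot.coe_le_coe.1 h1
  · intro h x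
    obtain ⟨p, hp, halg, hA⟩ := hloc x
    rw [IsLocalization.AtPrime.ringKrullDim_eq_height p]
    rcases le_or_gt 2 p.height with h2 | h2
    · obtain ⟨y, hy, hyr⟩ := hnz p hp (by
        intro h0; rw [h0] at h2; exact absurd h2 (by norm_num))
      refine (min_le_left _ _).trans ?_
      exact WithBot.coe_le_coe.2 (h.two_le_localDepth h2 _ hy hyr)
    · refine (min_le_right _ _).trans ?_
      rw [WithBot.coe_le_coe]
      by_cases h0 : p.height = 0
      · rw [h0]; exact zero_le
      · obtain ⟨y, hy, hyr⟩ := hnz p hp h0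
        refine le_trans (show p.height ≤ 1 by simpa using h2) ?_
        exact one_le_localDepth
          ((IsLocalization.AtPrime.to_map_mem_maximal_iff _ p y).2 hy)
          (algebraMap_mem_nonZeroDivisors (p := p) _ hyr)

end Serre

theorem isDomain_addMonoidAlgebra (k : Type v) [Field k] (M : Type u) [AddCommGroup M]
    [Module.Free ℤ M] : IsDomain (AddMonoidAlgebra k M) := by
  have : UniqueSums M :=
    UniqueSums.of_injective_addHom (Module.Free.chooseBasis ℤ M).repr.toAddEquiv.toAddHom
      (Module.Free.chooseBasis ℤ M).repr.injective inferInstance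
  infer_instance

/-! ### Interior elements of the semigroups -/

namespace MonoidalComplex

variable {M : Type u} [AddCommGroup M] {𝓜 : MonoidalComplex M}

theorem S_mono {σ τ : 𝓜.fan.cones} (h : (σ : Cone M) ≤ τ) : 𝓜.S σ ≤ 𝓜.S τ := by
  intro m hm
  exact mem_of_toReal_mem hm (h (toReal_mem hm))

theorem le_of_isOrderUnit_mem {σ τ : 𝓜.fan.cones} {u : RealSpace M}
    (hu : IsOrderUnit (σ : Cone M) u) (h : u ∈ (τ : Cone M)) : (σ : Cone M) ≤ τ :=
  (hu.le_of_mem (𝓜.fan.inter_face σ σ.2 τ τ.2).1 le_rfl ⟨hu.1, h⟩).trans inf_le_right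

theorem exists_isOrderUnit (σ : 𝓜.fan.cones) :
    ∃ u ∈ 𝓜.S σ, IsOrderUnit (σ : Cone M) (toReal u) := by
  classical
  obtain ⟨B, hB⟩ := 𝓜.fg σ
  let f : M →+ RealSpace M := ⟨⟨toReal, toReal_zero⟩, toReal_add⟩
  have hσ : (σ : Cone M) =
      PointedCone.hull ℝ ((B.image toReal : Finset (RealSpace M)) : Set (RealSpace M)) := by
    rw [← 𝓜.generates σ, ← hB]
    refine le_antisymm (Submodule.span_le.2 ?_) ?_
    · have : AddSubmonoid.closure (B : Set M) ≤ AddSubmonoid.comap f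
          (PointedCone.hull ℝ ((B.image toReal : Finset (RealSpace M)) :
            Set (RealSpace M))).toAddSubmonoid :=
        AddSubmonoid.closure_le.2 fun b hb =>
          PointedCone.subset_hull (Finset.mem_coe.2 (Finset.mem_image_of_mem _ hb))
      rintro _ ⟨m, hm, rfl⟩
      exact this hm
    · rw [Finset.coe_image]
      exact coneOf_mono AddSubmonoid.subset_closure
  have hu := exists_isOrderUnit_hull (B.image (toReal : M → RealSpace M))
  rw [← hσ] at hu
  have hmem : ∑ a ∈ B.image toReal, a ∈ AddSubmonoid.map f (𝓜.S σ) := by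
    refine sum_mem fun a ha => ?_
    obtain ⟨b, hb, rfl⟩ := Finset.mem_image.1 ha
    exact ⟨b, hB ▸ AddSubmonoid.subset_closure hb, rfl⟩
  obtain ⟨u, huS, huf⟩ := hmem
  exact ⟨u, huS, by rw [show toReal u = _ from huf]; exact hu⟩

/-- Every element of `|𝓜|` is in the relative interior of some cone. -/
theorem exists_isOrderUnit_of_mem_support {u : M} (hsupp : u ∈ 𝓜.support) :
    ∃ ρ : 𝓜.fan.cones, u ∈ 𝓜.S ρ ∧ IsOrderUnit (ρ : Cone M) (toReal u) := by
  obtain ⟨σ, hσ⟩ := hsupp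
  let ρ : 𝓜.fan.cones := ⟨minFace (σ : Cone M) (toReal u),
    𝓜.fan.face_mem σ σ.2 _ (minFace_isFaceOf _ _)⟩
  have hu : IsOrderUnit (ρ : Cone M) (toReal u) := isOrderUnit_minFace (toReal_mem hσ)
  exact ⟨ρ, mem_of_toReal_mem hσ hu.1, hu⟩

variable [Module.Free ℤ M]

/-- Multiplicatively, each monomial of S_ρ divides a power of an interior monomial. -/
theorem exists_nsmul_eq_add {ρ : 𝓜.fan.cones} {u v : M}
    (hunit : IsOrderUnit (ρ : Cone M) (toReal u)) (hv : v ∈ 𝓜.S ρ) :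
    ∃ n : ℕ, ∃ s ∈ 𝓜.S ρ, n • u = v + s := by
  obtain ⟨N, hN⟩ := hunit.2 _ (toReal_mem hv)
  rw [← toReal_nsmul, ← toReal_sub, ← 𝓜.generates ρ] at hN
  obtain ⟨n, hn, hmem⟩ := exists_nsmul_mem_of_toReal_mem hN
  -- A positive multiplier is needed here: one copy of v is split off from (n + 1) v.
  obtain ⟨n, rfl⟩ := Nat.exists_eq_succ_of_ne_zero hn.ne'
  refine ⟨(n + 1) * N, n • v + (n + 1) • (N • u - v),
    add_mem (nsmul_mem hv _) hmem, ?_⟩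
  rw [smul_sub, mul_nsmul, succ_nsmul v]
  rw [smul_comm N (n + 1) u]
  abel

variable [Module.Finite ℤ M]

/-- For u interior to τ, the smallest face containing u + t contains τ and t, hence is σ. So u + t
is interior to σ, and its multiples dominate b. -/
theorem exists_nsmul_add_eq_add {τ σ : 𝓜.fan.cones} (h : IsCodimOneFace (τ : Cone M) σ)
    {t b : M} (ht : t ∈ 𝓜.S σ) (htτ : t ∉ 𝓜.S τ) (hb : b ∈ 𝓜.S σ) :
    ∃ n : ℕ, ∃ r ∈ 𝓜.S τ, ∃ s ∈ 𝓜.S σ, n • t + r = b + s := by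
  obtain ⟨u, huτ, hu⟩ := exists_isOrderUnit τ
  have huσ : u ∈ 𝓜.S σ := S_mono h.1.le huτ
  have hut := add_mem huσ ht
  have hface := minFace_isFaceOf (σ : Cone M) (toReal (u + t))
  have hself := self_mem_minFace (toReal_mem hut)
  have hu' : toReal u ∈ minFace (σ : Cone M) (toReal (u + t)) := by
    rw [toReal_add] at hself ⊢
    rw [toReal_add] at hface
    exact hface.mem_of_add_mem_left (toReal_mem huσ) (toReal_mem ht) hself
  have ht' : toReal t ∈ minFace (σ : Cone M) (toReal (u + t)) := by
    rw [toReal_add] at hself ⊢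
    rw [toReal_add] at hface
    exact hface.mem_of_add_mem_right (toReal_mem huσ) (toReal_mem ht) hself
  have hunit := isOrderUnit_minFace (toReal_mem hut)
  rcases h.eq_or_eq hface (hu.le_of_mem hface h.1.le hu') with he | he
  · rw [he] at ht'
    exact absurd (mem_of_toReal_mem ht ht') htτ
  · rw [he] at hunit
    obtain ⟨n, s, hs, heq⟩ := exists_nsmul_eq_add hunit hb
    exact ⟨n, n • u, nsmul_mem huτ n, s, hs, by rw [← heq, smul_add, add_comm]⟩

end MonoidalComplex

/-! ### Projections of the toric face ring, monomials and prime ideals -/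

namespace ToricFaceRing

open MonoidalComplex

variable {k : Type v} [Field k] {M : Type u} [AddCommGroup M] {𝓜 : MonoidalComplex M}

theorem chi_mul_chi (a b : 𝓜.support) : chi k a * chi k b = chiMul k a b := mulBilin_chi a b

theorem chi_mul_chi_of_mem {σ : 𝓜.fan.cones} {a b : M} (ha : a ∈ 𝓜.S σ) (hb : b ∈ 𝓜.S σ) :
    chi k ⟨a, σ, ha⟩ * chi k ⟨b, σ, hb⟩ = (chi k ⟨a + b, σ, add_mem ha hb⟩ :
      ToricFaceRing k 𝓜) := by
  rw [chi_mul_chi, chiMul, dif_pos ⟨σ, ha, hb⟩]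

theorem chi_pow {σ : 𝓜.fan.cones} {a : M} (ha : a ∈ 𝓜.S σ) (n : ℕ) :
    chi k ⟨a, σ, ha⟩ ^ n = (chi k ⟨n • a, σ, nsmul_mem ha n⟩ : ToricFaceRing k 𝓜) := by
  induction n with
  | zero => simp only [pow_zero, zero_smul]; rfl
  | succ n ih =>
    rw [pow_succ, ih, chi_mul_chi_of_mem (nsmul_mem ha n) ha]
    simp only [succ_nsmul]

instance : Algebra k (ToricFaceRing k 𝓜) :=
  Algebra.ofModule (fun c f g => by simp [mul_def]) (fun c f g => by simp [mul_def])

open scoped Classical in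
variable (k) in
/-- The linear map underlying `evalHom`. -/
def evalLin (σ : 𝓜.fan.cones) {H : Type*} [AddCommMonoid H] (j : 𝓜.S σ →+ H) :
    ToricFaceRing k 𝓜 →ₗ[k] AddMonoidAlgebra k H :=
  (basis k 𝓜).constr k fun m =>
    if h : (m : M) ∈ 𝓜.S σ then AddMonoidAlgebra.single (j ⟨m, h⟩) 1 else 0

open scoped Classical in
theorem evalLin_chi (σ : 𝓜.fan.cones) {H : Type*} [AddCommMonoid H] (j : 𝓜.S σ →+ H)
    (m : 𝓜.support) : evalLin k σ j (chi k m) =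
      if h : (m : M) ∈ 𝓜.S σ then AddMonoidAlgebra.single (j ⟨m, h⟩) 1 else 0 := by
  simp [evalLin, chi]

/-- Killing the monomials outside S_σ is multiplicative because compatible a, b with a + b in S_σ
are themselves in S_σ (`mem_of_add_mem`). -/
theorem evalLin_mul (σ : 𝓜.fan.cones) {H : Type*} [AddCommMonoid H] (j : 𝓜.S σ →+ H)
    (f g : ToricFaceRing k 𝓜) : evalLin k σ j (f * g) = evalLin k σ j f * evalLin k σ j g := by
  have key : (mulBilin k 𝓜).compr₂ (evalLin k σ j) =
      (LinearMap.mul k (AddMonoidAlgebra k H)).compl₁₂ (evalLin k σ j) (evalLin k σ j) := by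
    refine (basis k 𝓜).ext fun a => (basis k 𝓜).ext fun b => ?_
    change evalLin k σ j (mulBilin k 𝓜 (chi k a) (chi k b)) =
      evalLin k σ j (chi k a) * evalLin k σ j (chi k b)
    rw [mulBilin_chi, evalLin_chi, evalLin_chi]
    by_cases ha : (a : M) ∈ 𝓜.S σ
    · by_cases hb : (b : M) ∈ 𝓜.S σ
      · rw [chiMul, dif_pos ⟨σ, ha, hb⟩, evalLin_chi, dif_pos ha, dif_pos hb,
          dif_pos (add_mem ha hb), AddMonoidAlgebra.single_mul_single, one_mul, ← map_add]
        rfl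
      · rw [dif_neg hb, mul_zero, chiMul]
        split_ifs with h
        · obtain ⟨τ, ha', hb'⟩ := h
          rw [evalLin_chi, dif_neg fun hab => hb (mem_of_add_mem ha' hb' hab).2]
        · exact map_zero _
    · rw [dif_neg ha, zero_mul, chiMul]
      split_ifs with h
      · obtain ⟨τ, ha', hb'⟩ := h
        rw [evalLin_chi, dif_neg fun hab => ha (mem_of_add_mem ha' hb' hab).1]
      · exact map_zero _
  exact LinearMap.congr_fun₂ key f g

variable (k) in
/-- The ring homomorphism `k[𝓜] → k[S_σ] → k[H]` for a monoid homomorphism `S_σ → H`. -/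
def evalHom (σ : 𝓜.fan.cones) {H : Type*} [AddCommMonoid H] (j : 𝓜.S σ →+ H) :
    ToricFaceRing k 𝓜 →+* AddMonoidAlgebra k H where
  toFun := evalLin k σ j
  map_one' := by
    rw [one_def, evalLin_chi, dif_pos (zero_mem _), AddMonoidAlgebra.one_def]
    congr 1
    exact j.map_zero
  map_mul' := evalLin_mul σ j
  map_zero' := map_zero _
  map_add' := map_add _

variable (k) in
/-- The projection `k[𝓜] → k[S_σ] ⊆ k[M]`. -/
def proj (σ : 𝓜.fan.cones) : ToricFaceRing k 𝓜 →+* AddMonoidAlgebra k M :=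
  evalHom k σ (𝓜.S σ).subtype

open scoped Classical in
/-- The coefficient of an element of the toric face ring at a lattice point. -/
def coeffAt (r : ToricFaceRing k 𝓜) (m : M) : k :=
  if h : m ∈ 𝓜.support then (basis k 𝓜).repr r ⟨m, h⟩ else 0

theorem coeffAt_of_notMem (r : ToricFaceRing k 𝓜) {m : M} (h : m ∉ 𝓜.support) :
    coeffAt r m = 0 := dif_neg h

theorem coeffAt_mk (r : ToricFaceRing k 𝓜) (m : 𝓜.support) :
    coeffAt r m = (basis k 𝓜).repr r m := dif_pos m.2

theorem ext_coeffAt {r s : ToricFaceRing k 𝓜} (h : ∀ m ∈ 𝓜.support, coeffAt r m = coeffAt s m) :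
    r = s := by
  refine (basis k 𝓜).repr.injective (Finsupp.ext fun m => ?_)
  rw [← coeffAt_mk, ← coeffAt_mk]
  exact h m m.2

theorem coeffAt_add (r s : ToricFaceRing k 𝓜) (m : M) :
    coeffAt (r + s) m = coeffAt r m + coeffAt s m := by
  by_cases h : m ∈ 𝓜.support
  · lift m to 𝓜.support using h
    simp [coeffAt_mk]
  · simp [coeffAt_of_notMem _ h]

theorem coeffAt_smul (c : k) (r : ToricFaceRing k 𝓜) (m : M) :
    coeffAt (c • r) m = c * coeffAt r m := by
  by_cases h : m ∈ 𝓜.support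
  · lift m to 𝓜.support using h
    simp [coeffAt_mk]
  · simp [coeffAt_of_notMem _ h]

open scoped Classical in
theorem coeffAt_chi (a : 𝓜.support) (m : M) :
    coeffAt (chi k a) m = if (a : M) = m then 1 else 0 := by
  by_cases h : m ∈ 𝓜.support
  · lift m to 𝓜.support using h
    rw [coeffAt_mk, chi, Module.Basis.repr_self, Finsupp.single_apply]
    simp only [Subtype.ext_iff]
  · rw [coeffAt_of_notMem _ h, if_neg]
    rintro rfl
    exact h a.2

open scoped Classical in
theorem coeff_proj (σ : 𝓜.fan.cones) (r : ToricFaceRing k 𝓜) (m : M) :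
    (proj k σ r).coeff m = if m ∈ 𝓜.S σ then coeffAt r m else 0 := by
  have hlin : ∀ r : ToricFaceRing k 𝓜, proj k σ r = evalLin k σ (𝓜.S σ).subtype r := fun _ => rfl
  induction (basis k 𝓜).mem_span r using Submodule.span_induction with
  | zero => simp [hlin, coeffAt]
  | add r s _ _ hr hs =>
    rw [map_add, AddMonoidAlgebra.coeff_add, Finsupp.add_apply, hr, hs, coeffAt_add]
    split_ifs <;> simp
  | smul c r _ hr =>
    rw [hlin, map_smul, AddMonoidAlgebra.coeff_smul, Finsupp.smul_apply, ← hlin, hr,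
      coeffAt_smul]
    split_ifs <;> simp
  | mem r ha =>
    obtain ⟨a, rfl⟩ := ha
    change (proj k σ (chi k a)).coeff m = if m ∈ 𝓜.S σ then coeffAt (chi k a) m else 0
    rw [hlin, evalLin_chi, coeffAt_chi]
    by_cases ha : (a : M) ∈ 𝓜.S σ
    · rw [dif_pos ha, AddMonoidAlgebra.coeff_single, Finsupp.single_apply]
      by_cases ham : (a : M) = m
      · subst ham; simp [ha]
      · simp [ham]
    · rw [dif_neg ha]
      by_cases ham : (a : M) = m
      · subst ham; simp [ha]
      · simp [ham]

theorem coeff_proj_of_mem {σ : 𝓜.fan.cones} (r : ToricFaceRing k 𝓜) {m : M} (hm : m ∈ 𝓜.S σ) :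
    (proj k σ r).coeff m = coeffAt r m := by
  classical rw [coeff_proj, if_pos hm]

theorem coeff_proj_of_notMem {σ : 𝓜.fan.cones} (r : ToricFaceRing k 𝓜) {m : M}
    (hm : m ∉ 𝓜.S σ) : (proj k σ r).coeff m = 0 := by
  classical rw [coeff_proj, if_neg hm]

theorem mem_of_coeff_proj_ne {σ : 𝓜.fan.cones} {r : ToricFaceRing k 𝓜} {m : M}
    (hm : (proj k σ r).coeff m ≠ 0) : m ∈ 𝓜.S σ := by
  by_contra h
  exact hm (coeff_proj_of_notMem r h)

open scoped Classical in
theorem proj_chi (σ : 𝓜.fan.cones) (a : 𝓜.support) :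
    proj k σ (chi k a) = if (a : M) ∈ 𝓜.S σ then AddMonoidAlgebra.single (a : M) 1 else 0 := by
  change evalLin k σ _ (chi k a) = _
  rw [evalLin_chi]
  split_ifs <;> rfl

theorem proj_chi_of_mem {σ : 𝓜.fan.cones} {a : 𝓜.support} (h : (a : M) ∈ 𝓜.S σ) :
    proj k σ (chi k a) = AddMonoidAlgebra.single (a : M) 1 := by
  classical rw [proj_chi, if_pos h]

theorem proj_chi_of_notMem {σ : 𝓜.fan.cones} {a : 𝓜.support} (h : (a : M) ∉ 𝓜.S σ) :
    proj k σ (chi k a) = 0 := by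
  classical rw [proj_chi, if_neg h]

theorem exists_facet_of_mem_support {m : M} (hm : m ∈ 𝓜.support) :
    ∃ F : 𝓜.fan.cones, 𝓜.fan.IsFacet F ∧ m ∈ 𝓜.S F := by
  obtain ⟨σ, hσ⟩ := hm
  obtain ⟨F, hF, hle⟩ := 𝓜.fan.exists_facet_ge σ.2
  exact ⟨⟨F, hF.mem⟩, hF, S_mono hle hσ⟩

/-- Each basis monomial lies in some facet, so the ring embeds in a product of domains indexed by
the facets. -/
theorem ext_proj {r s : ToricFaceRing k 𝓜}
    (h : ∀ F : 𝓜.fan.cones, 𝓜.fan.IsFacet F → proj k F r = proj k F s) : r = s := by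
  refine ext_coeffAt fun m hm => ?_
  obtain ⟨F, hF, hmF⟩ := exists_facet_of_mem_support hm
  rw [← coeff_proj_of_mem r hmF, ← coeff_proj_of_mem s hmF, h F hF]

/-- A function on `|𝓜|` of finite support is an element of the toric face ring. -/
theorem exists_coeffAt_eq (z : M → k) (hz : (Function.support z).Finite)
    (hsupp : ∀ m, z m ≠ 0 → m ∈ 𝓜.support) :
    ∃ r : ToricFaceRing k 𝓜, ∀ m, coeffAt r m = z m := by
  refine ⟨(basis k 𝓜).repr.symm (Finsupp.ofSupportFinite (fun m => z m)
    (hz.preimage Subtype.val_injective.injOn)), fun m => ?_⟩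
  by_cases h : m ∈ 𝓜.support
  · lift m to 𝓜.support using h
    rw [coeffAt_mk, LinearEquiv.apply_symm_apply]
    rfl
  · rw [coeffAt_of_notMem _ h]
    by_contra hne
    exact h (hsupp m (Ne.symm hne))

variable (k) in
/-- The prime ideal of the toric face ring given by a cone: the kernel of the projection to
`k[S_σ]`. -/
def conePrime (σ : 𝓜.fan.cones) : Ideal (ToricFaceRing k 𝓜) := RingHom.ker (proj k σ)

theorem mem_conePrime {σ : 𝓜.fan.cones} {r : ToricFaceRing k 𝓜} :
    r ∈ conePrime k σ ↔ proj k σ r = 0 := Iff.rfl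

theorem mem_conePrime_iff {σ : 𝓜.fan.cones} {r : ToricFaceRing k 𝓜} :
    r ∈ conePrime k σ ↔ ∀ m ∈ 𝓜.S σ, coeffAt r m = 0 := by
  rw [mem_conePrime]
  constructor
  · intro h m hm
    rw [← coeff_proj_of_mem r hm, h]; rfl
  · intro h
    ext m
    classical
    rw [coeff_proj]
    split_ifs with hm
    · exact h m hm
    · rfl

theorem conePrime_anti {σ τ : 𝓜.fan.cones} (h : (σ : Cone M) ≤ τ) :
    conePrime k τ ≤ conePrime k σ := by
  intro r hr
  rw [mem_conePrime_iff] at *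
  exact fun m hm => hr m (S_mono h hm)

theorem chi_mem_conePrime_iff {σ : 𝓜.fan.cones} {a : 𝓜.support} :
    chi k a ∈ conePrime k σ ↔ (a : M) ∉ 𝓜.S σ := by
  classical
  rw [mem_conePrime, proj_chi]
  split_ifs with h <;> simp [h]

theorem conePrime_le {σ : 𝓜.fan.cones} {I : Ideal (ToricFaceRing k 𝓜)}
    (h : ∀ a : 𝓜.support, (a : M) ∉ 𝓜.S σ → chi k a ∈ I) : conePrime k σ ≤ I := by
  intro r hr
  rw [mem_conePrime_iff] at hr
  rw [← (basis k 𝓜).linearCombination_repr r, Finsupp.linearCombination_apply]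
  refine sum_mem fun a ha => ?_
  change _ • chi k a ∈ I
  rw [Algebra.smul_def]
  refine I.mul_mem_left _ (h a fun haσ => ?_)
  rw [Finsupp.mem_support_iff, ← coeffAt_mk] at ha
  exact ha (hr a haσ)

theorem conePrime_le_iff {σ τ : 𝓜.fan.cones} :
    conePrime k σ ≤ conePrime k τ ↔ (τ : Cone M) ≤ σ := by
  refine ⟨fun h => ?_, conePrime_anti⟩
  obtain ⟨u, huS, hu⟩ := exists_isOrderUnit τ
  by_contra hle
  have : chi k (⟨u, τ, huS⟩ : 𝓜.support) ∈ conePrime k σ :=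
    chi_mem_conePrime_iff.2 fun hmem => hle (le_of_isOrderUnit_mem hu (toReal_mem hmem))
  exact chi_mem_conePrime_iff.1 (h this) huS

section Domain

variable [Module.Free ℤ M]

instance (σ : 𝓜.fan.cones) : (conePrime k σ).IsPrime :=
  have := isDomain_addMonoidAlgebra k M
  RingHom.ker_isPrime _

/-- The monomials outside of a prime ideal are those of one of the semigroups `S_ρ`. -/
theorem exists_forall_chi_notMem_iff (q : Ideal (ToricFaceRing k 𝓜)) [hq : q.IsPrime] :
    ∃ ρ : 𝓜.fan.cones, ∀ a : 𝓜.support, chi k a ∉ q ↔ (a : M) ∈ 𝓜.S ρ := by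
  -- Every monomial outside q is interior to a cone of D. A maximal cone of D absorbs them all: the
  -- product of its interior monomial with χ^a is outside q, so it is nonzero and lies over a cone
  -- of D containing both.
  let D : Set 𝓜.fan.cones := {ρ | ∀ a : 𝓜.support, (a : M) ∈ 𝓜.S ρ → chi k a ∉ q}
  have hD : ∀ a : 𝓜.support, chi k a ∉ q → ∃ ρ ∈ D, (a : M) ∈ 𝓜.S ρ := by
    intro a ha
    obtain ⟨ρ, haρ, hunit⟩ := exists_isOrderUnit_of_mem_support a.2
    refine ⟨ρ, fun b hb hbq => ?_, haρ⟩
    obtain ⟨n, s, hs, heq⟩ := exists_nsmul_eq_add (u := (a : M)) (v := (b : M)) hunit hb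
    have h1 : chi k (⟨(a : M), ρ, haρ⟩ : 𝓜.support) ^ n ∈ q := by
      rw [chi_pow haρ]
      simp only [heq]
      rw [← chi_mul_chi_of_mem hb hs]
      exact q.mul_mem_right _ hbq
    exact ha (hq.mem_of_pow_mem n h1)
  have : Finite 𝓜.fan.cones := 𝓜.fan.finite.to_subtype
  have hne : D.Nonempty := by
    have h0 : chi k (⟨0, 𝓜.zero_mem_support⟩ : 𝓜.support) ∉ q := by
      rw [← one_def]
      exact fun h => hq.ne_top ((Ideal.eq_top_iff_one _).2 h)
    obtain ⟨ρ, hρ, -⟩ := hD _ h0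
    exact ⟨ρ, hρ⟩
  obtain ⟨ρ, hρ⟩ := D.toFinite.exists_maximal hne
  refine ⟨ρ, fun a => ⟨fun ha => ?_, fun ha => hρ.prop a ha⟩⟩
  obtain ⟨τ, hτ, haτ⟩ := hD a ha
  obtain ⟨u, huS, hu⟩ := exists_isOrderUnit ρ
  have hprod : chi k ⟨u, ρ, huS⟩ * chi k a ∉ q := fun h =>
    (hq.mem_or_mem h).elim (hρ.prop _ huS) ha
  have hcomp : 𝓜.Compatible u a := by
    by_contra hc
    rw [chi_mul_chi, chiMul, dif_neg hc] at hprod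
    exact hprod q.zero_mem
  rw [chi_mul_chi, chiMul, dif_pos hcomp] at hprod
  obtain ⟨π, hπ, hsum⟩ := hD _ hprod
  obtain ⟨τ', hu', ha'⟩ := hcomp
  obtain ⟨huπ, haπ⟩ := mem_of_add_mem hu' ha' hsum
  have hle : ρ ≤ π := le_of_isOrderUnit_mem hu (toReal_mem huπ)
  exact S_mono (hρ.2 hπ hle) haπ

theorem exists_conePrime_le (q : Ideal (ToricFaceRing k 𝓜)) [hq : q.IsPrime] :
    ∃ ρ : 𝓜.fan.cones, (∀ a : 𝓜.support, chi k a ∉ q ↔ (a : M) ∈ 𝓜.S ρ) ∧ conePrime k ρ ≤ q := by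
  obtain ⟨ρ, hρ⟩ := exists_forall_chi_notMem_iff q
  exact ⟨ρ, hρ, conePrime_le fun a ha => not_not.1 fun h => ha ((hρ a).1 h)⟩

theorem exists_facet_conePrime_le (q : Ideal (ToricFaceRing k 𝓜)) [hq : q.IsPrime] :
    ∃ F : 𝓜.fan.cones, 𝓜.fan.IsFacet F ∧ conePrime k F ≤ q := by
  obtain ⟨ρ, -, hρ⟩ := exists_conePrime_le q
  obtain ⟨F, hF, hle⟩ := 𝓜.fan.exists_facet_ge ρ.2
  exact ⟨⟨F, hF.mem⟩, hF, (conePrime_anti hle).trans hρ⟩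

/-- Every prime contains the prime of some facet, and these are pairwise incomparable. -/
theorem height_conePrime_facet {F : 𝓜.fan.cones} (hF : 𝓜.fan.IsFacet F) :
    (conePrime k F).height = 0 := by
  rw [Ideal.height_eq_zero_iff]
  refine ⟨⟨inferInstance, bot_le⟩, fun q hq hle => ?_⟩
  have := hq.1
  obtain ⟨G, hG, hGq⟩ := exists_facet_conePrime_le q
  have h1 : (F : Cone M) ≤ G := conePrime_le_iff.1 (hGq.trans hle)
  have h2 : F = G := Subtype.ext (hF.eq_of_le G.2 h1)
  exact h2 ▸ hGq

theorem mem_nonZeroDivisors_iff {x : ToricFaceRing k 𝓜} :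
    x ∈ nonZeroDivisors (ToricFaceRing k 𝓜) ↔
      ∀ F : 𝓜.fan.cones, 𝓜.fan.IsFacet F → proj k F x ≠ 0 := by
  have := isDomain_addMonoidAlgebra k M
  constructor
  · intro hx F hF h0
    obtain ⟨u, huS, hu⟩ := exists_isOrderUnit F
    -- The interior monomial of F vanishes on all other facets, so it annihilates an x that vanishes
    -- on F.
    have h1 : chi k (⟨u, F, huS⟩ : 𝓜.support) * x = 0 := by
      refine ext_proj fun G hG => ?_
      rw [map_mul, map_zero]
      by_cases hGF : F = G
      · subst hGF; rw [h0, mul_zero]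
      · rw [proj_chi_of_notMem, zero_mul]
        exact fun hmem => hGF (Subtype.ext (hF.eq_of_le G.2
          (le_of_isOrderUnit_mem hu (toReal_mem hmem))))
    have h2 := (mem_nonZeroDivisors_iff_right.1 hx) _ h1
    have h3 := proj_chi_of_mem (k := k) (a := ⟨u, F, huS⟩) huS
    rw [h2, map_zero] at h3
    exact one_ne_zero (AddMonoidAlgebra.single_eq_zero.1 h3.symm)
  · intro h
    rw [mem_nonZeroDivisors_iff_right]
    intro r hr
    refine ext_proj fun F hF => ?_
    have := congrArg (proj k F) hr
    rw [map_mul, map_zero] at this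
    rw [map_zero]
    exact (mul_eq_zero.1 this).resolve_right (h F hF)

/-- The zero divisors are the union of the facet primes, which have height 0; prime avoidance
applies. -/
theorem exists_nonZeroDivisor_mem (p : Ideal (ToricFaceRing k 𝓜)) [p.IsPrime]
    (hp : p.height ≠ 0) : ∃ x ∈ p, x ∈ nonZeroDivisors (ToricFaceRing k 𝓜) := by
  have : Finite 𝓜.fan.cones := 𝓜.fan.finite.to_subtype
  by_contra! h
  have hsub : (p : Set (ToricFaceRing k 𝓜)) ⊆
      ⋃ F ∈ {F : 𝓜.fan.cones | 𝓜.fan.IsFacet F}, (conePrime k F : Set (ToricFaceRing k 𝓜)) := by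
    intro x hx
    have := h x hx
    rw [mem_nonZeroDivisors_iff] at this
    push Not at this
    obtain ⟨F, hF, h0⟩ := this
    exact Set.mem_biUnion (s := {F : 𝓜.fan.cones | 𝓜.fan.IsFacet F}) hF h0
  -- Prime avoidance exempts two indices from primality. All ideals are prime here, so an arbitrary
  -- cone fills both places.
  obtain ⟨F, hF, hle⟩ := (Ideal.subset_union_prime_finite
    (Set.toFinite {F : 𝓜.fan.cones | 𝓜.fan.IsFacet F}) (f := conePrime k)
    ⟨_, 𝓜.fan.nonempty.some_mem⟩ ⟨_, 𝓜.fan.nonempty.some_mem⟩ fun _ _ _ _ => inferInstance).1 hsub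
  have := Ideal.height_mono hle
  rw [height_conePrime_facet hF] at this
  exact hp (nonpos_iff_eq_zero.1 this)

end Domain

instance : IsNoetherianRing (ToricFaceRing k 𝓜) := by
  have : Finite 𝓜.fan.cones := 𝓜.fan.finite.to_subtype
  choose B hB using 𝓜.fg
  let Γ : Set (ToricFaceRing k 𝓜) :=
    ⋃ σ, (fun b : 𝓜.support => chi k b) '' (Subtype.val ⁻¹' (B σ : Set M))
  have hΓ : Γ.Finite := Set.finite_iUnion fun σ =>
    ((B σ).finite_toSet.preimage Subtype.val_injective.injOn).image _
  have hchi : ∀ a : 𝓜.support, chi k a ∈ Algebra.adjoin k Γ := by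
    rintro ⟨a, σ, ha⟩
    have key : ∀ x ∈ AddSubmonoid.closure (B σ : Set M), ∀ hx : x ∈ 𝓜.support,
        chi k (⟨x, hx⟩ : 𝓜.support) ∈ Algebra.adjoin k Γ := by
      intro x hx
      induction hx using AddSubmonoid.closure_induction with
      | mem x h => exact fun hx => Algebra.subset_adjoin (Set.mem_iUnion.2 ⟨σ, ⟨x, hx⟩, h, rfl⟩)
      | zero => exact fun _ => one_mem _
      | add x y hx hy ihx ihy =>
        intro hxy
        rw [hB] at hx hy
        rw [← chi_mul_chi_of_mem hx hy]
        exact mul_mem (ihx _) (ihy _)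
    exact key a (by rw [hB]; exact ha) _
  have hft : Algebra.FiniteType k (ToricFaceRing k 𝓜) := by
    refine ⟨Subalgebra.fg_def.2 ⟨Γ, hΓ, ?_⟩⟩
    rw [eq_top_iff]
    intro r _
    rw [← (basis k 𝓜).linearCombination_repr r, Finsupp.linearCombination_apply]
    exact sum_mem fun a _ => Subalgebra.smul_mem _ (hchi a) _
  exact Algebra.FiniteType.isNoetherianRing k _

theorem satisfiesSerre_iff [Module.Free ℤ M] :
    SatisfiesSerre (toricVariety k 𝓜) 2 ↔ DvdInCodimOne (ToricFaceRing k 𝓜) :=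
  satisfiesSerre_two_iff fun p _ hp0 => exists_nonZeroDivisor_mem p hp0

end ToricFaceRing

/-! ### Laurent polynomial rings are factorial -/

section Factorization

theorem uniqueFactorizationMonoid_laurent (k : Type v) [Field k] (n : ℕ) :
    IsDomain (AddMonoidAlgebra k (Fin n → ℤ)) ∧
      UniqueFactorizationMonoid (AddMonoidAlgebra k (Fin n → ℤ)) := by
  refine ⟨isDomain_addMonoidAlgebra k _, ?_⟩
  induction n with
  | zero =>
    let e : AddMonoidAlgebra k (Fin 0 → ℤ) ≃+* k := AddMonoidAlgebra.uniqueRingEquiv _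
    exact e.symm.toMulEquiv.uniqueFactorizationMonoid inferInstance
  | succ n ih =>
    have := isDomain_addMonoidAlgebra k (Fin n → ℤ)
    have hL : UniqueFactorizationMonoid (LaurentPolynomial (AddMonoidAlgebra k (Fin n → ℤ))) :=
      UniqueFactorizationMonoid.of_isLocalization (Submonoid.powers
        (Polynomial.X : Polynomial (AddMonoidAlgebra k (Fin n → ℤ)))) _
    let e : AddMonoidAlgebra k (Fin (n + 1) → ℤ) ≃+*
        LaurentPolynomial (AddMonoidAlgebra k (Fin n → ℤ)) :=
      (AddMonoidAlgebra.mapDomainRingEquiv k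
        (Fin.consLinearEquiv ℤ fun _ => ℤ).symm.toAddEquiv).trans
        AddMonoidAlgebra.curryRingEquiv
    exact e.toMulEquiv.symm.uniqueFactorizationMonoid hL

theorem uniqueFactorizationMonoid_addMonoidAlgebra (k : Type v) [Field k] (M : Type u)
    [AddCommGroup M] [Module.Free ℤ M] [Module.Finite ℤ M] :
    UniqueFactorizationMonoid (AddMonoidAlgebra k M) :=
  (AddMonoidAlgebra.mapDomainRingEquiv k
    (Module.finBasis ℤ M).equivFun.symm.toAddEquiv).toMulEquiv.uniqueFactorizationMonoid
    (uniqueFactorizationMonoid_laurent k _).2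

/-- Cancel the prime factors of a one at a time: some j ∈ J is not divisible by p, so p must divide
w. -/
theorem dvd_of_forall_prime_exists {D : Type*} [CommRing D] [IsDomain D]
    [UniqueFactorizationMonoid D] {J : Set D} {a : D} (ha : a ≠ 0)
    (hJ : ∀ p : D, Prime p → ∃ j ∈ J, ¬ p ∣ j) (w : D) (hw : ∀ j ∈ J, a ∣ j * w) : a ∣ w := by
  induction a using UniqueFactorizationMonoid.induction_on_prime generalizing w with
  | h₁ => exact absurd rfl ha
  | h₂ x hx => exact hx.dvd
  | h₃ a p ha0 hp ih =>
    obtain ⟨j, hj, hpj⟩ := hJ p hp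
    obtain ⟨w, rfl⟩ := (hp.dvd_or_dvd ((dvd_mul_right p a).trans (hw j hj))).resolve_left hpj
    refine mul_dvd_mul_left p (ih ha0 w fun j hj => ?_)
    have := hw j hj
    rw [mul_left_comm] at this
    exact (mul_dvd_mul_iff_left hp.ne_zero).1 this

end Factorization

/-! ### Supports in the group algebra -/

section Restrict

variable {k : Type v} [Field k] {M : Type u}

open scoped Classical in
/-- The part of an element of the group algebra supported in `P`. -/
def restrict (P : M → Prop) (x : AddMonoidAlgebra k M) : AddMonoidAlgebra k M :=
  .ofCoeff (x.coeff.filter P)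

theorem coeff_restrict_of_pos {P : M → Prop} (x : AddMonoidAlgebra k M) {m : M} (h : P m) :
    (restrict P x).coeff m = x.coeff m := by
  classical exact Finsupp.filter_apply_pos P _ h

theorem coeff_restrict_of_neg {P : M → Prop} (x : AddMonoidAlgebra k M) {m : M} (h : ¬ P m) :
    (restrict P x).coeff m = 0 := by
  classical exact Finsupp.filter_apply_neg P _ h

theorem coeff_restrict_ne {P : M → Prop} {x : AddMonoidAlgebra k M} {m : M}
    (h : (restrict P x).coeff m ≠ 0) : P m ∧ x.coeff m ≠ 0 := by
  by_cases hP : P m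
  · exact ⟨hP, by rwa [coeff_restrict_of_pos x hP] at h⟩
  · exact absurd (coeff_restrict_of_neg x hP) h

theorem coeff_sub_restrict_ne {P : M → Prop} {x : AddMonoidAlgebra k M} {m : M}
    (h : (x - restrict P x).coeff m ≠ 0) : ¬ P m ∧ x.coeff m ≠ 0 := by
  rw [AddMonoidAlgebra.coeff_sub, Finsupp.sub_apply] at h
  by_cases hP : P m
  · rw [coeff_restrict_of_pos x hP, sub_self] at h
    exact absurd rfl h
  · exact ⟨hP, by rwa [coeff_restrict_of_neg x hP, sub_zero] at h⟩

variable [AddCommGroup M]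

theorem exists_of_coeff_mul_ne {x y : AddMonoidAlgebra k M} {e : M} (h : (x * y).coeff e ≠ 0) :
    ∃ a b, x.coeff a ≠ 0 ∧ y.coeff b ≠ 0 ∧ a + b = e := by
  classical
  have := AddMonoidAlgebra.support_coeff_mul_subset x y (Finsupp.mem_support_iff.2 h)
  obtain ⟨a, ha, b, hb, hab⟩ := Finset.mem_add.1 this
  exact ⟨a, b, Finsupp.mem_support_iff.1 ha, Finsupp.mem_support_iff.1 hb, hab⟩

/-- The hypothesis is the face property on the supports: cross terms never land in P. -/
theorem restrict_mul {P : M → Prop} {x y : AddMonoidAlgebra k M}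
    (h : ∀ a b, x.coeff a ≠ 0 → y.coeff b ≠ 0 → (P (a + b) ↔ P a ∧ P b)) :
    restrict P (x * y) = restrict P x * restrict P y := by
  have hxy : x * y = restrict P x * restrict P y +
      (restrict P x * (y - restrict P y) + (x - restrict P x) * y) := by ring
  ext e
  by_cases he : P e
  · rw [coeff_restrict_of_pos _ he, hxy, AddMonoidAlgebra.coeff_add, Finsupp.add_apply]
    convert add_zero _
    by_contra hne
    rw [AddMonoidAlgebra.coeff_add, Finsupp.add_apply] at hne
    by_cases h1 : (restrict P x * (y - restrict P y)).coeff e = 0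
    · rw [h1, zero_add] at hne
      obtain ⟨a, b, ha, hb, rfl⟩ := exists_of_coeff_mul_ne hne
      obtain ⟨ha', ha⟩ := coeff_sub_restrict_ne ha
      exact ha' ((h a b ha hb).1 he).1
    · obtain ⟨a, b, ha, hb, rfl⟩ := exists_of_coeff_mul_ne h1
      obtain ⟨hb', hb⟩ := coeff_sub_restrict_ne hb
      exact hb' ((h a b (coeff_restrict_ne ha).2 hb).1 he).2
  · rw [coeff_restrict_of_neg _ he]
    by_contra hne
    obtain ⟨a, b, ha, hb, rfl⟩ := exists_of_coeff_mul_ne (Ne.symm hne)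
    obtain ⟨hPa, ha⟩ := coeff_restrict_ne ha
    obtain ⟨hPb, hb⟩ := coeff_restrict_ne hb
    exact he ((h a b ha hb).2 ⟨hPa, hPb⟩)

/-- If `f` is supported in `S`, with a nonzero coefficient in the face `T` of `S`, and `f * z` is
supported in `S`, then `z` is supported in `S - T`. -/
theorem exists_sub_of_coeff_ne [Module.Free ℤ M] {S T : AddSubmonoid M}
    (h : M →+ ℝ) (hS : ∀ s ∈ S, 0 ≤ h s) (hT : ∀ t ∈ T, h t = 0)
    (hST : ∀ s ∈ S, h s = 0 → s ∈ T) {f z : AddMonoidAlgebra k M}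
    (hf : ∀ m, f.coeff m ≠ 0 → m ∈ S) (hfT : ∃ m ∈ T, f.coeff m ≠ 0)
    (hfz : ∀ m, (f * z).coeff m ≠ 0 → m ∈ S) {m : M} (hm : z.coeff m ≠ 0) :
    ∃ s ∈ S, ∃ t ∈ T, m = s - t := by
  classical
  have := isDomain_addMonoidAlgebra k M
  by_contra hmL
  let Q : M → Prop := fun m => ¬ ∃ s ∈ S, ∃ t ∈ T, m = s - t
  set z' := restrict Q z with hz'
  have hm' : m ∈ z'.coeff.support := by
    rw [Finsupp.mem_support_iff, coeff_restrict_of_pos z hmL]; exact hm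
  -- Take the part z' of z outside S - T, its layer z₀ of least height h, and the part f₀ of f in T.
  -- The product f₀ z₀ is nonzero in a domain, and at a point e of its support no other terms
  -- contribute to f z. So e ∈ S, although e is outside S - T.
  obtain ⟨y, hy, hymin⟩ := z'.coeff.support.exists_min_image h ⟨m, hm'⟩
  set z₀ := restrict (fun x => h x = h y) z' with hz₀
  set f₀ := restrict (fun x => x ∈ T) f with hf₀
  have hz₀0 : z₀ ≠ 0 := by
    intro h0
    have h1 := coeff_restrict_of_pos (P := fun x => h x = h y) z' (m := y) rfl
    rw [← hz₀, h0] at h1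
    exact Finsupp.mem_support_iff.1 hy h1.symm
  have hf₀0 : f₀ ≠ 0 := by
    intro h0
    obtain ⟨t, ht, hft⟩ := hfT
    have h1 := coeff_restrict_of_pos (P := fun x => x ∈ T) f ht
    rw [← hf₀, h0] at h1
    exact hft h1.symm
  obtain ⟨e, he⟩ : ∃ e, (f₀ * z₀).coeff e ≠ 0 := by
    by_contra! hall
    exact mul_ne_zero hf₀0 hz₀0 (AddMonoidAlgebra.ext (Finsupp.ext hall))
  obtain ⟨a, b, ha, hb, hab⟩ := exists_of_coeff_mul_ne he
  obtain ⟨haT, -⟩ := coeff_restrict_ne ha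
  obtain ⟨hby, hbz'⟩ := coeff_restrict_ne hb
  obtain ⟨hbQ, -⟩ := coeff_restrict_ne hbz'
  have heQ : Q e := by
    rintro ⟨s, hs, t, ht, rfl⟩
    refine hbQ ⟨s, hs, t + a, add_mem ht haT, ?_⟩
    rw [← sub_sub, ← hab]; abel
  have hhe : h e = h y := by rw [← hab, map_add, hT a haT, zero_add, hby]
  have h1 : (f * (z - z')).coeff e = 0 := by
    by_contra hne
    obtain ⟨a, b, ha, hb, hab⟩ := exists_of_coeff_mul_ne hne
    obtain ⟨s, hs, t, ht, rfl⟩ := not_not.1 (coeff_sub_restrict_ne hb).1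
    exact heQ ⟨a + s, add_mem (hf a ha) hs, t, ht, by rw [← hab]; abel⟩
  have h2 : (f₀ * (z' - z₀)).coeff e = 0 := by
    by_contra hne
    obtain ⟨a, b, ha, hb, hab⟩ := exists_of_coeff_mul_ne hne
    obtain ⟨hb1, hb2⟩ := coeff_sub_restrict_ne hb
    rw [← hab, map_add, hT a (coeff_restrict_ne ha).1, zero_add] at hhe
    exact hb1 hhe
  have h3 : ((f - f₀) * z').coeff e = 0 := by
    by_contra hne
    obtain ⟨a, b, ha, hb, hab⟩ := exists_of_coeff_mul_ne hne
    obtain ⟨ha1, ha2⟩ := coeff_sub_restrict_ne ha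
    have hb1 := hymin b (Finsupp.mem_support_iff.2 hb)
    have ha3 : 0 < h a := (hS a (hf a ha2)).lt_of_ne fun h0 => ha1 (hST a (hf a ha2) h0.symm)
    rw [← hab, map_add] at hhe
    linarith
  have hfze : (f * z).coeff e = (f₀ * z₀).coeff e := by
    have : f * z = f₀ * z₀ + (f * (z - z') + f₀ * (z' - z₀) + (f - f₀) * z') := by ring
    rw [this, AddMonoidAlgebra.coeff_add, AddMonoidAlgebra.coeff_add,
      AddMonoidAlgebra.coeff_add, Finsupp.add_apply, Finsupp.add_apply, Finsupp.add_apply,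
      h1, h2, h3, add_zero, add_zero, add_zero]
  exact heQ ⟨e, hfz e (hfze ▸ he), 0, zero_mem _, (sub_zero e).symm⟩

end Restrict

/-- The group `S - S` generated by a semigroup. -/
def differenceGroup {M : Type u} [AddCommGroup M] (S : AddSubmonoid M) : AddSubgroup M where
  carrier := {m | ∃ s ∈ S, ∃ t ∈ S, m = s - t}
  add_mem' := by
    rintro _ _ ⟨s, hs, t, ht, rfl⟩ ⟨s', hs', t', ht', rfl⟩
    exact ⟨s + s', add_mem hs hs', t + t', add_mem ht ht', by abel⟩
  zero_mem' := ⟨0, zero_mem _, 0, zero_mem _, by simp⟩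
  neg_mem' := by
    rintro _ ⟨s, hs, t, ht, rfl⟩
    exact ⟨t, ht, s, hs, by abel⟩

/-- The inclusion of a semigroup `S` into the group `S - S`. -/
def toDifferenceGroup {M : Type u} [AddCommGroup M] (S : AddSubmonoid M) :
    S →+ differenceGroup S where
  toFun s := ⟨s, s, s.2, 0, zero_mem _, by simp⟩
  map_zero' := rfl
  map_add' _ _ := rfl

/-! ### Dimensions of facets under 1-connectedness, and the S₂-closure -/

namespace MonoidalComplex

variable {M : Type u} [AddCommGroup M] {𝓜 : MonoidalComplex M}

/-- Consecutive facets of a chain share a face of codimension one in both. -/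
theorem coneDim_eq_of_isOneConnected (h : 𝓜.fan.IsOneConnected) {F G : Cone M}
    (hF : 𝓜.fan.IsFacet F) (hG : 𝓜.fan.IsFacet G) : coneDim F = coneDim G := by
  by_cases hne : F = G
  · rw [hne]
  obtain ⟨n, H, rfl, rfl, -, hH⟩ := h F G hF hG hne
  have key : ∀ i ≤ n, coneDim (H 0) = coneDim (H i) := by
    intro i
    induction i with
    | zero => exact fun _ => rfl
    | succ i ih =>
      intro hi
      rw [ih (by omega), ← (hH i (by omega)).1.2, ← (hH i (by omega)).2.2]
  exact key n le_rfl

theorem isCodimOneFace_of_isOneConnected (h : 𝓜.fan.IsOneConnected) {F G τ : Cone M}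
    (hF : 𝓜.fan.IsFacet F) (hG : 𝓜.fan.IsFacet G) (hτ : IsCodimOneFace τ F) (hle : τ ≤ G) :
    IsCodimOneFace τ G :=
  ⟨Fan.isFaceOf_of_le (𝓜.fan.face_mem F hF.mem τ hτ.1) hG.mem hle,
    hτ.2.trans (coneDim_eq_of_isOneConnected h hF hG)⟩

theorem toReal_mem_of_mem_s2Closure [Module.Finite ℤ M] (F : 𝓜.fan.cones) {m : M}
    (hm : m ∈ s2Closure (𝓜.S F)) : toReal m ∈ (F : Cone M) := by
  obtain ⟨⟨s, hs, t, ht, rfl⟩, hcodim⟩ := hm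
  refine 𝓜.fan.mem_of_forall_isCodimOneFace F.2
    ⟨_, toReal_mem hs, _, toReal_mem ht, toReal_sub s t⟩ fun τ hτ => ?_
  rw [𝓜.generates F] at hcodim
  obtain ⟨s', hs', t', -, ht', heq⟩ := hcodim τ hτ
  exact ⟨_, toReal_mem hs', _, ht', by rw [heq, toReal_sub]⟩

end MonoidalComplex

/-! ### Primes of height at most one -/

namespace ToricFaceRing

open MonoidalComplex

variable {k : Type v} [Field k] {M : Type u} [AddCommGroup M] {𝓜 : MonoidalComplex M}

/-- A sum of monomials `χ^u`, one for each facet `F` in a set, with `u` in the relative interior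
of `F`. -/
theorem exists_sum_chi (t : 𝓜.fan.cones → M) (htS : ∀ σ, t σ ∈ 𝓜.S σ)
    (ht : ∀ σ : 𝓜.fan.cones, IsOrderUnit (σ : Cone M) (toReal (t σ)))
    (A : Set 𝓜.fan.cones) (hA : ∀ F ∈ A, 𝓜.fan.IsFacet F) :
    ∃ x : ToricFaceRing k 𝓜, (∀ F ∈ A, proj k F x = AddMonoidAlgebra.single (t F) 1) ∧
      ∀ I : Ideal (ToricFaceRing k 𝓜), (∀ F ∈ A, chi k ⟨t F, F, htS F⟩ ∈ I) → x ∈ I := by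
  classical
  have : Finite 𝓜.fan.cones := 𝓜.fan.finite.to_subtype
  have hproj : ∀ F G : 𝓜.fan.cones, G ∈ A → F ≠ G →
      proj k F (chi k ⟨t G, G, htS G⟩ : ToricFaceRing k 𝓜) = 0 := by
    intro F G hG hne
    refine proj_chi_of_notMem fun hmem => hne ?_
    exact Subtype.ext ((hA G hG).eq_of_le F.2 (le_of_isOrderUnit_mem (ht G)
      (toReal_mem hmem))).symm
  refine ⟨∑ G ∈ A.toFinite.toFinset, chi k ⟨t G, G, htS G⟩, fun F hF => ?_,
    fun I hI => sum_mem fun F hF => hI F (A.toFinite.mem_toFinset.1 hF)⟩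
  rw [map_sum, Finset.sum_eq_single F]
  · exact proj_chi_of_mem (a := ⟨t F, F, htS F⟩) (htS F)
  · exact fun G hG hne => hproj F G (A.toFinite.mem_toFinset.1 hG) hne.symm
  · exact fun h => absurd (A.toFinite.mem_toFinset.2 hF) h

/-- Krull's principal ideal theorem: the prime of ρ is minimal over the sum x of interior monomials
of the facets containing ρ. A prime q below it that contains x contains the prime of such a facet F,
hence the interior monomial of F. By `exists_nsmul_add_eq_add` it then contains each χ^a with a ∈
S_F outside S_ρ. -/
theorem height_conePrime_le_one [Module.Free ℤ M] [Module.Finite ℤ M] {ρ : 𝓜.fan.cones}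
    (h : ∀ F : 𝓜.fan.cones, 𝓜.fan.IsFacet F → (ρ : Cone M) ≤ F → IsCodimOneFace (ρ : Cone M) F) :
    (conePrime k ρ).height ≤ 1 := by
  choose t htS ht using exists_isOrderUnit (𝓜 := 𝓜)
  obtain ⟨x, hx, hxI⟩ := exists_sum_chi (k := k) t htS ht
    {F | 𝓜.fan.IsFacet F ∧ (ρ : Cone M) ≤ F} fun F hF => hF.1
  refine Ideal.height_le_one_of_isPrincipal_of_mem_minimalPrimes (Ideal.span {x}) _
    ⟨⟨inferInstance, ?_⟩, ?_⟩
  · rw [Ideal.span_singleton_le_iff_mem]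
    refine hxI _ fun F hF => chi_mem_conePrime_iff.2 fun hmem => ?_
    exact (h F hF.1 hF.2).ne (le_antisymm hF.2 (le_of_isOrderUnit_mem (ht F) (toReal_mem hmem)))
  · rintro q ⟨hq, hxq⟩ hle
    rw [Ideal.span_singleton_le_iff_mem] at hxq
    obtain ⟨F, hF, hFq⟩ := exists_facet_conePrime_le q
    have hρF : (ρ : Cone M) ≤ F := conePrime_le_iff.1 (hFq.trans hle)
    have htq : chi k (⟨t F, F, htS F⟩ : 𝓜.support) ∈ q := by
      have h1 : x - chi k (⟨t F, F, htS F⟩ : 𝓜.support) ∈ q := by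
        refine hFq ?_
        rw [mem_conePrime, map_sub, hx F ⟨hF, hρF⟩,
          proj_chi_of_mem (a := ⟨t F, F, htS F⟩) (htS F), sub_self]
      simpa using sub_mem hxq h1
    refine conePrime_le fun a ha => ?_
    by_cases haF : (a : M) ∈ 𝓜.S F
    · obtain ⟨n, r, hr, s, hs, heq⟩ := exists_nsmul_add_eq_add (h F hF hρF) haF ha (htS F)
      have hrF := S_mono hρF hr
      have h1 : chi k (⟨a, F, haF⟩ : 𝓜.support) ^ n * chi k (⟨r, F, hrF⟩ : 𝓜.support) ∈ q := by
        rw [chi_pow haF, chi_mul_chi_of_mem (nsmul_mem haF n) hrF]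
        simp only [heq]
        rw [← chi_mul_chi_of_mem (htS F) hs]
        exact q.mul_mem_right _ htq
      refine (hq.mem_or_mem h1).elim (fun h2 => hq.mem_of_pow_mem n h2) fun h2 => ?_
      exact absurd hr (chi_mem_conePrime_iff.1 (hle h2))
    · exact hFq (chi_mem_conePrime_iff.2 haF)

variable (k) in
/-- The projection `k[𝓜] → k[S_σ] ⊆ k[S_σ - S_σ]`. -/
def projGroup (σ : 𝓜.fan.cones) :
    ToricFaceRing k 𝓜 →+* AddMonoidAlgebra k (differenceGroup (𝓜.S σ)) :=
  evalHom k σ (toDifferenceGroup (𝓜.S σ))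

theorem mapDomain_projGroup (σ : 𝓜.fan.cones) (r : ToricFaceRing k 𝓜) :
    AddMonoidAlgebra.mapDomainRingHom k (differenceGroup (𝓜.S σ)).subtype (projGroup k σ r) =
      proj k σ r := by
  classical
  induction (basis k 𝓜).mem_span r using Submodule.span_induction with
  | zero => simp
  | add r s _ _ hr hs => rw [map_add, map_add, hr, hs, map_add]
  | smul c r _ hr =>
    have h1 : projGroup k σ (c • r) = c • projGroup k σ r := map_smul (evalLin k σ _) c r
    have h2 : proj k σ (c • r) = c • proj k σ r := map_smul (evalLin k σ _) c r
    rw [h1, h2, ← hr, Algebra.smul_def, Algebra.smul_def, map_mul]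
    congr 1
    simp
  | mem r ha =>
    obtain ⟨a, rfl⟩ := ha
    change AddMonoidAlgebra.mapDomainRingHom k (differenceGroup (𝓜.S σ)).subtype
      (evalLin k σ _ (chi k a)) = evalLin k σ _ (chi k a)
    rw [evalLin_chi, evalLin_chi]
    split_ifs
    · simp [toDifferenceGroup]
    · simp

theorem projGroup_chi {σ : 𝓜.fan.cones} {a : M} (ha : a ∈ 𝓜.S σ) :
    projGroup k σ (chi k ⟨a, σ, ha⟩) =
      AddMonoidAlgebra.single (toDifferenceGroup (𝓜.S σ) ⟨a, ha⟩) 1 := by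
  change evalLin k σ _ (chi k _) = _
  rw [evalLin_chi, dif_pos ha]

theorem isUnit_projGroup_chi {σ : 𝓜.fan.cones} {a : M} (ha : a ∈ 𝓜.S σ) :
    IsUnit (projGroup k σ (chi k ⟨a, σ, ha⟩)) := by
  rw [projGroup_chi ha]
  refine IsUnit.of_mul_eq_one (AddMonoidAlgebra.single (-toDifferenceGroup (𝓜.S σ) ⟨a, ha⟩) 1) ?_
  rw [AddMonoidAlgebra.single_mul_single, add_neg_cancel, one_mul, AddMonoidAlgebra.one_def]

theorem projGroup_eq_zero_iff {σ : 𝓜.fan.cones} {r : ToricFaceRing k 𝓜} :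
    projGroup k σ r = 0 ↔ proj k σ r = 0 := by
  rw [← mapDomain_projGroup]
  refine ⟨fun h => by rw [h, map_zero], fun h => ?_⟩
  exact AddMonoidAlgebra.mapDomain_injective Subtype.val_injective (h.trans (map_zero
    (AddMonoidAlgebra.mapDomainRingHom k (differenceGroup (𝓜.S σ)).subtype)).symm)

/-- `k[S_σ - S_σ]` is obtained from the image of `k[𝓜]` by inverting monomials. -/
theorem exists_projGroup_eq_mul (σ : 𝓜.fan.cones)
    (g : AddMonoidAlgebra k (differenceGroup (𝓜.S σ))) :
    ∃ (u : M) (hu : u ∈ 𝓜.S σ) (r : ToricFaceRing k 𝓜),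
      projGroup k σ r = projGroup k σ (chi k ⟨u, σ, hu⟩) * g := by
  induction g using AddMonoidAlgebra.induction_linear with
  | zero => exact ⟨0, zero_mem _, 0, by simp⟩
  | add f g hf hg =>
    obtain ⟨u, hu, r, hr⟩ := hf
    obtain ⟨u', hu', r', hr'⟩ := hg
    refine ⟨u + u', add_mem hu hu', chi k ⟨u', σ, hu'⟩ * r + chi k ⟨u, σ, hu⟩ * r', ?_⟩
    rw [← chi_mul_chi_of_mem hu hu', map_add, map_mul, map_mul, map_mul, hr, hr']
    ring
  | single m c =>
    obtain ⟨_, s, hs, t, ht, rfl⟩ := m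
    refine ⟨t, ht, c • chi k ⟨s, σ, hs⟩, ?_⟩
    have h1 : projGroup k σ (c • chi k ⟨s, σ, hs⟩) = c • projGroup k σ (chi k ⟨s, σ, hs⟩) :=
      map_smul (evalLin k σ _) c _
    rw [h1, projGroup_chi hs, projGroup_chi ht, AddMonoidAlgebra.single_mul_single,
      AddMonoidAlgebra.smul_single, one_mul, smul_eq_mul, mul_one]
    congr 1
    apply Subtype.ext
    simp [toDifferenceGroup]

/-- Multiplying p by a monomial gives the image of a ring element r, and the contraction of (p) is
minimal over r. It contains no monomial of S_F, since these become units; so F is the only facet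
whose prime can lie below it. -/
theorem height_comap_projGroup_le_one [Module.Free ℤ M] {F : 𝓜.fan.cones} (hF : 𝓜.fan.IsFacet F)
    {p : AddMonoidAlgebra k (differenceGroup (𝓜.S F))} (hp : Prime p) :
    (Ideal.comap (projGroup k F) (Ideal.span {p})).height ≤ 1 := by
  have hpI : (Ideal.span {p}).IsPrime := (Ideal.span_singleton_prime hp.ne_zero).2 hp
  have hchi : ∀ {a : M} (ha : a ∈ 𝓜.S F),
      chi k (⟨a, F, ha⟩ : 𝓜.support) ∉ Ideal.comap (projGroup k F) (Ideal.span {p}) :=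
    fun ha hmem => hpI.ne_top (Ideal.eq_top_of_isUnit_mem _ hmem (isUnit_projGroup_chi ha))
  obtain ⟨u, hu, r, hr⟩ := exists_projGroup_eq_mul F p
  refine Ideal.height_le_one_of_isPrincipal_of_mem_minimalPrimes (Ideal.span {r}) _
    ⟨⟨inferInstance, ?_⟩, ?_⟩
  · rw [Ideal.span_singleton_le_iff_mem, Ideal.mem_comap, hr]
    exact Ideal.mul_mem_left _ _ (Ideal.mem_span_singleton_self p)
  · rintro q ⟨hq, hrq⟩ hle y hy
    rw [Ideal.span_singleton_le_iff_mem] at hrq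
    have hFq : conePrime k F ≤ q := by
      obtain ⟨G, hG, hGq⟩ := exists_facet_conePrime_le q
      obtain ⟨t, htS, ht⟩ := exists_isOrderUnit F
      have htG : t ∈ 𝓜.S G := by
        by_contra hmem
        exact hchi htS (hle (hGq (chi_mem_conePrime_iff.2 hmem)))
      have : F = G := Subtype.ext (hF.eq_of_le G.2 (le_of_isOrderUnit_mem ht (toReal_mem htG)))
      exact this ▸ hGq
    obtain ⟨g, hg⟩ := Ideal.mem_span_singleton.1 (Ideal.mem_comap.1 hy)
    obtain ⟨u', hu', r', hr'⟩ := exists_projGroup_eq_mul F g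
    have h1 : chi k ⟨u, F, hu⟩ * (chi k ⟨u', F, hu'⟩ * y) - r * r' ∈ q := by
      refine hFq ?_
      rw [mem_conePrime, ← projGroup_eq_zero_iff, map_sub, map_mul, map_mul, map_mul, hr, hr', hg]
      ring
    have h2 : chi k ⟨u, F, hu⟩ * (chi k ⟨u', F, hu'⟩ * y) ∈ q := by
      simpa using add_mem h1 (q.mul_mem_right r' hrq)
    refine ((hq.mem_or_mem ((hq.mem_or_mem h2).resolve_left ?_)).resolve_left ?_)
    · exact fun h => hchi hu (hle h)
    · exact fun h => hchi hu' (hle h)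

end ToricFaceRing

/-! ### The two conditions imply S₂: quotients on the facets and gluing -/

namespace ToricFaceRing

open MonoidalComplex

variable {k : Type v} [Field k] {M : Type u} [AddCommGroup M] {𝓜 : MonoidalComplex M}

theorem restrict_proj {ρ F : 𝓜.fan.cones} (h : (ρ : Cone M) ≤ F) (r : ToricFaceRing k 𝓜) :
    restrict (fun m => toReal m ∈ (ρ : Cone M)) (proj k F r) = proj k ρ r := by
  ext m
  by_cases hm : toReal m ∈ (ρ : Cone M)
  · rw [coeff_restrict_of_pos (P := fun m => toReal m ∈ (ρ : Cone M)) _ hm]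
    by_cases hmF : m ∈ 𝓜.S F
    · rw [coeff_proj_of_mem _ hmF, coeff_proj_of_mem _ (mem_of_toReal_mem hmF hm)]
    · rw [coeff_proj_of_notMem _ hmF, coeff_proj_of_notMem _ fun hρ => hmF (S_mono h hρ)]
  · rw [coeff_restrict_of_neg (P := fun m => toReal m ∈ (ρ : Cone M)) _ hm,
      coeff_proj_of_notMem _ fun hρ => hm (toReal_mem hρ)]

variable [Module.Free ℤ M]

theorem mul_eq_proj {x w i r : ToricFaceRing k 𝓜} (hx : x ∈ nonZeroDivisors (ToricFaceRing k 𝓜))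
    {F : 𝓜.fan.cones} (hF : 𝓜.fan.IsFacet F) {z : AddMonoidAlgebra k M}
    (hz : proj k F w = proj k F x * z) (hr : i * w = x * r) :
    proj k F i * z = proj k F r := by
  have := isDomain_addMonoidAlgebra k M
  have h1 := congrArg (proj k F) hr
  rw [map_mul, map_mul, hz, mul_left_comm] at h1
  exact mul_left_cancel₀ (mem_nonZeroDivisors_iff.1 hx F hF) h1

variable [Module.Finite ℤ M]

/-- If `x` divides `w` in codimension one, then it does so in the group algebra of the group
generated by the semigroup of a facet. -/
theorem exists_proj_eq_mul {x w : ToricFaceRing k 𝓜}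
    (hx : x ∈ nonZeroDivisors (ToricFaceRing k 𝓜))
    (hw : ∀ q : Ideal (ToricFaceRing k 𝓜), q.IsPrime → q.height ≤ 1 → ∃ i ∉ q, x ∣ i * w)
    {F : 𝓜.fan.cones} (hF : 𝓜.fan.IsFacet F) :
    ∃ z : AddMonoidAlgebra k M, proj k F w = proj k F x * z ∧
      ∀ m, z.coeff m ≠ 0 → m ∈ differenceGroup (𝓜.S F) := by
  have : Module.Free ℤ (differenceGroup (𝓜.S F)) :=
    inferInstanceAs (Module.Free ℤ (AddSubgroup.toIntSubmodule (differenceGroup (𝓜.S F))))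
  have : Module.Finite ℤ (differenceGroup (𝓜.S F)) :=
    inferInstanceAs (Module.Finite ℤ (AddSubgroup.toIntSubmodule (differenceGroup (𝓜.S F))))
  have := isDomain_addMonoidAlgebra k (differenceGroup (𝓜.S F))
  have := uniqueFactorizationMonoid_addMonoidAlgebra k (differenceGroup (𝓜.S F))
  have hx0 : projGroup k F x ≠ 0 := fun h =>
    mem_nonZeroDivisors_iff.1 hx F hF (projGroup_eq_zero_iff.1 h)
  obtain ⟨c, hc⟩ := dvd_of_forall_prime_exists (J := projGroup k F '' {i | x ∣ i * w}) hx0 (by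
    intro p hp
    have hpI : (Ideal.span {p}).IsPrime := (Ideal.span_singleton_prime hp.ne_zero).2 hp
    obtain ⟨i, hi, hiw⟩ := hw _ inferInstance (height_comap_projGroup_le_one hF hp)
    refine ⟨_, ⟨i, hiw, rfl⟩, fun hdvd => hi ?_⟩
    exact Ideal.mem_comap.2 (Ideal.mem_span_singleton.2 hdvd)) (projGroup k F w) (by
    rintro _ ⟨i, hi, rfl⟩
    rw [← map_mul]
    exact map_dvd _ hi)
  refine ⟨AddMonoidAlgebra.mapDomainRingHom k (differenceGroup (𝓜.S F)).subtype c, ?_,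
    fun m hm => ?_⟩
  · rw [← mapDomain_projGroup, ← mapDomain_projGroup, hc, map_mul]
  · by_contra hmem
    refine hm ?_
    exact Finsupp.mapDomain_of_notMem_range _ _ (by simpa using hmem)

/-- The prime of a codimension one face τ has height at most one, so some i outside it makes i z
regular on F. Such an i has a nonzero coefficient on τ, and `exists_sub_of_coeff_ne` bounds the
support of z. -/
theorem mem_s2Closure_of_coeff_ne (hΔ : 𝓜.fan.IsOneConnected) {x w : ToricFaceRing k 𝓜}
    (hx : x ∈ nonZeroDivisors (ToricFaceRing k 𝓜))
    (hw : ∀ q : Ideal (ToricFaceRing k 𝓜), q.IsPrime → q.height ≤ 1 → ∃ i ∉ q, x ∣ i * w)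
    {F : 𝓜.fan.cones} (hF : 𝓜.fan.IsFacet F) {z : AddMonoidAlgebra k M}
    (hz : proj k F w = proj k F x * z)
    (hzF : ∀ m, z.coeff m ≠ 0 → m ∈ differenceGroup (𝓜.S F)) {m : M} (hm : z.coeff m ≠ 0) :
    m ∈ s2Closure (𝓜.S F) := by
  refine ⟨hzF m hm, fun τ hτ => ?_⟩
  rw [𝓜.generates F] at hτ
  let τ' : 𝓜.fan.cones := ⟨τ, 𝓜.fan.face_mem F F.2 τ hτ.1⟩
  obtain ⟨i, hi, r, hr⟩ := hw (conePrime k τ') inferInstance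
    (height_conePrime_le_one fun G hG hle => isCodimOneFace_of_isOneConnected hΔ hF hG hτ hle)
  have hir := mul_eq_proj hx hF hz hr
  obtain ⟨a, ha, hia⟩ : ∃ a ∈ 𝓜.S τ', coeffAt i a ≠ 0 := by
    by_contra! h
    exact hi (mem_conePrime_iff.2 h)
  obtain ⟨f, hf0, hfτ, hfF⟩ := hτ.exists_functional
  obtain ⟨s, hs, t, ht, heq⟩ := exists_sub_of_coeff_ne (S := 𝓜.S F) (T := 𝓜.S τ')
    (f.toAddMonoidHom.comp ⟨⟨toReal, toReal_zero⟩, toReal_add⟩)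
    (fun s hs => hf0 _ (toReal_mem hs)) (fun t ht => hfτ _ (toReal_mem ht))
    (fun s hs h0 => mem_of_toReal_mem hs (hfF _ (toReal_mem hs) h0))
    (f := proj k F i) (z := z) (fun m hm => mem_of_coeff_proj_ne hm)
    ⟨a, ha, by rwa [coeff_proj_of_mem i (S_mono hτ.1.le ha)]⟩
    (fun m hm => mem_of_coeff_proj_ne (k := k) (hir ▸ hm)) hm
  exact ⟨s, hs, t, S_mono hτ.1.le ht, toReal_mem ht, heq⟩

/-- With i outside the prime of ρ = F ∩ G and i w = x r, restricting i z = r to ρ gives the same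
equation for both quotients, and i is nonzero in the domain of ρ. -/
theorem coeff_eq_of_isCodimOneFace (hΔ : 𝓜.fan.IsOneConnected) {x w : ToricFaceRing k 𝓜}
    (hx : x ∈ nonZeroDivisors (ToricFaceRing k 𝓜))
    (hw : ∀ q : Ideal (ToricFaceRing k 𝓜), q.IsPrime → q.height ≤ 1 → ∃ i ∉ q, x ∣ i * w)
    {F G : 𝓜.fan.cones} (hF : 𝓜.fan.IsFacet F) (hG : 𝓜.fan.IsFacet G)
    (hFG : IsCodimOneFace ((F : Cone M) ⊓ G) F) {zF zG : AddMonoidAlgebra k M}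
    (hzF : proj k F w = proj k F x * zF) (hzG : proj k G w = proj k G x * zG)
    (hsF : ∀ m, zF.coeff m ≠ 0 → toReal m ∈ (F : Cone M))
    (hsG : ∀ m, zG.coeff m ≠ 0 → toReal m ∈ (G : Cone M))
    {m : M} (hmF : toReal m ∈ (F : Cone M)) (hmG : toReal m ∈ (G : Cone M)) :
    zF.coeff m = zG.coeff m := by
  have := isDomain_addMonoidAlgebra k M
  let ρ : 𝓜.fan.cones := ⟨(F : Cone M) ⊓ G, Fan.inf_mem F.2 G.2⟩
  obtain ⟨i, hi, r, hr⟩ := hw (conePrime k ρ) inferInstance (height_conePrime_le_one fun H hH hle =>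
    isCodimOneFace_of_isOneConnected hΔ hF hH hFG hle)
  have key : ∀ H : 𝓜.fan.cones, 𝓜.fan.IsFacet H → (ρ : Cone M) ≤ H → ∀ z : AddMonoidAlgebra k M,
      proj k H w = proj k H x * z → (∀ m, z.coeff m ≠ 0 → toReal m ∈ (H : Cone M)) →
      proj k ρ i * restrict (fun m => toReal m ∈ (ρ : Cone M)) z = proj k ρ r := by
    intro H hH hle z hz hs
    have hface := Fan.isFaceOf_of_le ρ.2 H.2 hle
    rw [← restrict_proj hle i, ← restrict_proj hle r, ← mul_eq_proj hx hH hz hr, restrict_mul]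
    intro a b ha hb
    rw [toReal_add]
    exact hface.add_mem_iff_mem (toReal_mem (mem_of_coeff_proj_ne ha)) (hs b hb)
  have h1 := (key F hF inf_le_left zF hzF hsF).trans (key G hG inf_le_right zG hzG hsG).symm
  have h2 := mul_left_cancel₀ (fun h0 => hi (mem_conePrime.2 h0)) h1
  have hmρ : toReal m ∈ (ρ : Cone M) := ⟨hmF, hmG⟩
  have h3 := coeff_restrict_of_pos (P := fun m => toReal m ∈ (ρ : Cone M)) zF hmρ
  rw [← h3, h2]
  exact coeff_restrict_of_pos (P := fun m => toReal m ∈ (ρ : Cone M)) zG hmρ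

theorem dvdInCodimOne_of_isOneConnected (hΔ : 𝓜.fan.IsOneConnected)
    (hS : ∀ σ : 𝓜.fan.cones, (𝓜.S σ : Set M) =
      {m | toReal m ∈ (σ : Cone M) ∧ ∀ F : 𝓜.fan.cones, 𝓜.fan.IsFacet F →
        toReal m ∈ (F : Cone M) → m ∈ s2Closure (𝓜.S F)}) :
    DvdInCodimOne (ToricFaceRing k 𝓜) := by
  classical
  intro x hx w hw
  have : Finite 𝓜.fan.cones := 𝓜.fan.finite.to_subtype
  have hex : ∀ F : 𝓜.fan.cones, ∃ z : AddMonoidAlgebra k M, 𝓜.fan.IsFacet F →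
      proj k F w = proj k F x * z ∧ ∀ m, z.coeff m ≠ 0 → m ∈ s2Closure (𝓜.S F) := by
    intro F
    by_cases hF : 𝓜.fan.IsFacet F
    · obtain ⟨z, hz, hzF⟩ := exists_proj_eq_mul hx hw hF
      exact ⟨z, fun _ => ⟨hz, fun m hm => mem_s2Closure_of_coeff_ne hΔ hx hw hF hz hzF hm⟩⟩
    · exact ⟨0, fun h => absurd h hF⟩
  choose z hz using hex
  have hzcone : ∀ F : 𝓜.fan.cones, 𝓜.fan.IsFacet F → ∀ m, (z F).coeff m ≠ 0 →
      toReal m ∈ (F : Cone M) := fun F hF m hm =>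
    toReal_mem_of_mem_s2Closure F ((hz F hF).2 m hm)
  have hglue : ∀ F G : 𝓜.fan.cones, 𝓜.fan.IsFacet F → 𝓜.fan.IsFacet G → ∀ m,
      toReal m ∈ (F : Cone M) → toReal m ∈ (G : Cone M) → (z F).coeff m = (z G).coeff m := by
    intro F G hF hG m hmF hmG
    by_cases hne : F = G
    · rw [hne]
    obtain ⟨n, H, h0, hn, hH, hstep⟩ := hΔ F G hF hG fun h => hne (Subtype.ext h)
    have hmH : ∀ i ≤ n, toReal m ∈ H i := fun i hi => (hH i hi).2 ⟨hmF, hmG⟩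
    have key : ∀ i, ∀ hi : i ≤ n,
        (z F).coeff m = (z ⟨H i, (hH i hi).1.mem⟩).coeff m := by
      intro i
      induction i with
      | zero =>
        intro hi
        congr 3
        exact Subtype.ext h0.symm
      | succ i ih =>
        intro hi
        have hi' : i ≤ n := by omega
        rw [ih hi']
        exact coeff_eq_of_isCodimOneFace hΔ hx hw (F := ⟨H i, _⟩) (G := ⟨H (i + 1), _⟩)
          (hH i hi').1 (hH _ hi).1 (hstep i (by omega)).1 (hz _ (hH i hi').1).1
          (hz _ (hH _ hi).1).1 (hzcone _ (hH i hi').1) (hzcone _ (hH _ hi).1)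
          (hmH i hi') (hmH _ hi)
    rw [key n le_rfl]
    congr 3
    exact Subtype.ext hn
  -- By gluing, m is in the support of z_G for every facet G containing m, so it lies in every S'_G
  -- and condition 2 applies.
  have hmem : ∀ F : 𝓜.fan.cones, 𝓜.fan.IsFacet F → ∀ m, (z F).coeff m ≠ 0 → m ∈ 𝓜.S F := by
    intro F hF m hm
    have hmF := hzcone F hF m hm
    change m ∈ (𝓜.S F : Set M)
    rw [hS F]
    refine ⟨hmF, fun G hG hmG => (hz G hG).2 m ?_⟩
    rwa [← hglue F G hF hG m hmF hmG]
  let Z : M → k := fun m =>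
    if h : ∃ F : 𝓜.fan.cones, 𝓜.fan.IsFacet F ∧ toReal m ∈ (F : Cone M) then
      (z h.choose).coeff m else 0
  have hZ : ∀ F : 𝓜.fan.cones, 𝓜.fan.IsFacet F → ∀ m, toReal m ∈ (F : Cone M) →
      Z m = (z F).coeff m := by
    intro F hF m hm
    have h : ∃ F : 𝓜.fan.cones, 𝓜.fan.IsFacet F ∧ toReal m ∈ (F : Cone M) := ⟨F, hF, hm⟩
    simp only [Z, dif_pos h]
    exact hglue _ _ h.choose_spec.1 hF m h.choose_spec.2 hm
  have hZne : ∀ m, Z m ≠ 0 → ∃ F : 𝓜.fan.cones, 𝓜.fan.IsFacet F ∧ (z F).coeff m ≠ 0 := by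
    intro m hm
    by_cases h : ∃ F : 𝓜.fan.cones, 𝓜.fan.IsFacet F ∧ toReal m ∈ (F : Cone M)
    · obtain ⟨F, hF, hmF⟩ := h
      exact ⟨F, hF, by rwa [← hZ F hF m hmF]⟩
    · exact absurd (dif_neg h) hm
  obtain ⟨r, hr⟩ := exists_coeffAt_eq (𝓜 := 𝓜) Z
    ((Set.finite_iUnion fun F => (z F).coeff.support.finite_toSet).subset fun m hm => by
      obtain ⟨F, -, hF⟩ := hZne m hm
      exact Set.mem_iUnion.2 ⟨F, Finsupp.mem_support_iff.2 hF⟩)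
    fun m hm => by
      obtain ⟨F, hF, hne⟩ := hZne m hm
      exact ⟨F, hmem F hF m hne⟩
  refine ⟨r, ext_proj fun F hF => ?_⟩
  rw [map_mul, (hz F hF).1]
  congr 1
  ext m
  by_cases hm : m ∈ 𝓜.S F
  · rw [coeff_proj_of_mem r hm, hr, hZ F hF m (toReal_mem hm)]
  · rw [coeff_proj_of_notMem r hm]
    by_contra hne
    exact hm (hmem F hF m hne)

end ToricFaceRing

/-! ### S₂ implies the two conditions: extending monomials by zero -/

namespace ToricFaceRing

open MonoidalComplex

variable {k : Type v} [Field k] {M : Type u} [AddCommGroup M] {𝓜 : MonoidalComplex M}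

open scoped Classical in
variable (k) in
/-- The elements `i` of the toric face ring for which the family of elements of the `k[S_F]` which
is `i χ^m` for the facets `F ∈ A` and zero for the other facets comes from the toric face ring. -/
def monomialColon (A : Set 𝓜.fan.cones) (m : M) : Ideal (ToricFaceRing k 𝓜) where
  carrier := {i | ∃ r : ToricFaceRing k 𝓜, ∀ F : 𝓜.fan.cones, 𝓜.fan.IsFacet F →
    proj k F r = if F ∈ A then proj k F i * AddMonoidAlgebra.single m 1 else 0}
  add_mem' := by
    rintro i j ⟨r, hr⟩ ⟨s, hs⟩
    refine ⟨r + s, fun F hF => ?_⟩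
    rw [map_add, hr F hF, hs F hF, map_add]
    split_ifs
    · ring
    · ring
  zero_mem' := ⟨0, fun F _ => by simp⟩
  smul_mem' := by
    rintro c i ⟨r, hr⟩
    refine ⟨c * r, fun F hF => ?_⟩
    rw [map_mul, hr F hF, smul_eq_mul, map_mul]
    split_ifs
    · ring
    · ring

theorem chi_mem_monomialColon_of_forall_notMem {A : Set 𝓜.fan.cones} {m : M} {u : 𝓜.support}
    (h : ∀ F ∈ A, (u : M) ∉ 𝓜.S F) : chi k u ∈ monomialColon k A m := by
  refine ⟨0, fun F _ => ?_⟩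
  split_ifs with hF
  · rw [proj_chi_of_notMem (h F hF), zero_mul, map_zero]
  · rw [map_zero]

theorem mem_of_add_mem_S {F G : 𝓜.fan.cones} {u m : M} (hu : u ∈ 𝓜.S F)
    (hm : toReal m ∈ (F : Cone M)) (hsum : u + m ∈ 𝓜.S G) :
    u ∈ 𝓜.S G ∧ toReal m ∈ (G : Cone M) := by
  have hface := (𝓜.fan.inter_face F F.2 G G.2).1
  have h : toReal u + toReal m ∈ (F : Cone M) ⊓ G := by
    refine ⟨add_mem (toReal_mem hu) hm, ?_⟩
    rw [← toReal_add]
    exact toReal_mem hsum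
  exact ⟨mem_of_toReal_mem hu (hface.mem_of_add_mem_left (toReal_mem hu) hm h).2,
    (hface.mem_of_add_mem_right (toReal_mem hu) hm h).2⟩

/-- The witness is χ^(u+m): on a facet of A it survives exactly when χ^u does, and by `hA` it
vanishes on the facets outside A. -/
theorem chi_mem_monomialColon_of_add_mem {A : Set 𝓜.fan.cones} {m : M}
    (hmA : ∀ F ∈ A, toReal m ∈ (F : Cone M)) {F₀ : 𝓜.fan.cones} (hF₀ : F₀ ∈ A) {u : 𝓜.support}
    (hu : (u : M) ∈ 𝓜.S F₀) (hum : (u : M) + m ∈ 𝓜.S F₀)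
    (hA : ∀ F : 𝓜.fan.cones, 𝓜.fan.IsFacet F → (u : M) + m ∈ 𝓜.S F → F ∈ A) :
    chi k u ∈ monomialColon k A m := by
  refine ⟨chi k ⟨u + m, F₀, hum⟩, fun F hF => ?_⟩
  split_ifs with hFA
  · by_cases huF : (u : M) ∈ 𝓜.S F
    · have h1 : (u : M) + m ∈ 𝓜.S F := by
        refine mem_of_toReal_mem hum ?_
        rw [toReal_add]
        exact add_mem (toReal_mem huF) (hmA F hFA)
      rw [proj_chi_of_mem (a := ⟨u + m, F₀, hum⟩) h1, proj_chi_of_mem huF,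
        AddMonoidAlgebra.single_mul_single, one_mul]
    · rw [proj_chi_of_notMem (a := ⟨u + m, F₀, hum⟩) fun h1 =>
        huF (mem_of_add_mem_S hu (hmA F₀ hF₀) h1).1, proj_chi_of_notMem huF, zero_mul]
  · exact proj_chi_of_notMem (a := ⟨u + m, F₀, hum⟩) fun h1 => hFA (hA F hF h1)

variable [Module.Free ℤ M] [Module.Finite ℤ M]

/-- The cones of the prime ideals of height at most one are the facets and the cones which are of
codimension one in every facet containing them. -/
theorem eq_or_isCodimOneFace_of_height_le_one {q : Ideal (ToricFaceRing k 𝓜)} (hq : q.height ≤ 1)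
    {ρ F : 𝓜.fan.cones} (hρ : conePrime k ρ ≤ q) (hF : (ρ : Cone M) ≤ F) :
    ρ = F ∨ IsCodimOneFace (ρ : Cone M) F := by
  by_contra! hcon
  obtain ⟨hne, hcodim⟩ := hcon
  refine hcodim (isCodimOneFace_of_maximal (𝓜.fan.rational F F.2) (𝓜.fan.rational ρ ρ.2)
    (Fan.isFaceOf_of_le ρ.2 F.2 hF) (fun h => hne (Subtype.ext h)) fun σ hσ hle => ?_)
  by_contra! hσne
  let σ' : 𝓜.fan.cones := ⟨σ, 𝓜.fan.face_mem F F.2 σ hσ⟩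
  -- A face strictly between ρ and F would give a chain of three primes below q.
  have h1 : conePrime k F < conePrime k σ' :=
    lt_of_le_not_ge (conePrime_anti hσ.le) fun h =>
      hσne.2 (le_antisymm hσ.le (conePrime_le_iff.1 h))
  have h2 : conePrime k σ' < conePrime k ρ :=
    lt_of_le_not_ge (conePrime_anti hle) fun h => hσne.1 (le_antisymm (conePrime_le_iff.1 h) hle)
  have h3 := Ideal.height_add_one_le_of_lt_of_isPrime h1
  have h4 := Ideal.height_add_one_le_of_lt_of_isPrime h2
  have h5 : (1 : ℕ∞) + 1 ≤ 1 :=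
    calc (1 : ℕ∞) + 1 ≤ (conePrime k F).height + 1 + 1 := by gcongr; exact le_add_self
      _ ≤ (conePrime k σ').height + 1 := by gcongr
      _ ≤ (conePrime k ρ).height := h4
      _ ≤ q.height := Ideal.height_mono hρ
      _ ≤ 1 := hq
  exact absurd h5 (by norm_num)

open scoped Classical in
-- The family is a fraction w/x, where x is a sum of interior monomials of the facets lying in the
-- colon ideal. A prime of height at most one omits the monomials of a cone covered by `hA`, so w/x
-- passes the codimension one test.
theorem exists_proj_eq_single (h : DvdInCodimOne (ToricFaceRing k 𝓜)) (A : Set 𝓜.fan.cones) (m : M)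
    (hA : ∀ ρ : 𝓜.fan.cones, (∀ F : 𝓜.fan.cones, 𝓜.fan.IsFacet F → (ρ : Cone M) ≤ F →
      ρ = F ∨ IsCodimOneFace (ρ : Cone M) F) →
      ∃ (u : M) (hu : u ∈ 𝓜.S ρ), chi k ⟨u, ρ, hu⟩ ∈ monomialColon k A m) :
    ∃ r : ToricFaceRing k 𝓜, ∀ F : 𝓜.fan.cones, 𝓜.fan.IsFacet F →
      proj k F r = if F ∈ A then AddMonoidAlgebra.single m 1 else 0 := by
  have := isDomain_addMonoidAlgebra k M
  have hex : ∀ σ : 𝓜.fan.cones, ∃ (t : M) (ht : t ∈ 𝓜.S σ), IsOrderUnit (σ : Cone M) (toReal t) ∧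
      (𝓜.fan.IsFacet σ → chi k ⟨t, σ, ht⟩ ∈ monomialColon k A m) := by
    intro σ
    obtain ⟨t, htS, ht⟩ := exists_isOrderUnit σ
    by_cases hσ : 𝓜.fan.IsFacet σ
    · obtain ⟨u, hu, huA⟩ := hA σ fun F hF hle => Or.inl (Subtype.ext (hσ.eq_of_le F.2 hle))
      -- Adding u to an interior point t keeps it interior and puts its monomial in the colon ideal.
      refine ⟨t + u, add_mem htS hu, ?_, fun _ => ?_⟩
      · rw [toReal_add]
        exact ht.add (toReal_mem hu)
      · rw [← chi_mul_chi_of_mem htS hu]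
        exact Ideal.mul_mem_left _ _ huA
    · exact ⟨t, htS, ht, fun h => absurd h hσ⟩
  choose t htS ht htA using hex
  obtain ⟨x, hx, hxI⟩ := exists_sum_chi (k := k) t htS ht {F | 𝓜.fan.IsFacet F} fun F hF => hF
  have hx0 : ∀ F : 𝓜.fan.cones, 𝓜.fan.IsFacet F → proj k F x ≠ 0 := by
    intro F hF h0
    rw [hx F hF] at h0
    exact one_ne_zero (AddMonoidAlgebra.single_eq_zero.1 h0)
  obtain ⟨w, hw⟩ := hxI (monomialColon k A m) fun F hF => htA F hF
  obtain ⟨r, hr⟩ := h x (mem_nonZeroDivisors_iff.2 hx0) w (by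
    intro q hq hq1
    obtain ⟨ρ, hρ, hle⟩ := exists_conePrime_le q
    obtain ⟨u, hu, s, hs⟩ := hA ρ fun F _ hF => eq_or_isCodimOneFace_of_height_le_one hq1 hle hF
    refine ⟨chi k ⟨u, ρ, hu⟩, (hρ _).2 hu, s, ext_proj fun F hF => ?_⟩
    rw [map_mul, map_mul, hw F hF, hs F hF]
    split_ifs
    · ring
    · rw [mul_zero, mul_zero])
  refine ⟨r, fun F hF => mul_left_cancel₀ (hx0 F hF) ?_⟩
  rw [← map_mul, ← hr, hw F hF]
  split_ifs
  · rfl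
  · rw [mul_zero]

theorem eq_setOf_of_dvdInCodimOne (h : DvdInCodimOne (ToricFaceRing k 𝓜)) (σ : 𝓜.fan.cones) :
    (𝓜.S σ : Set M) =
      {m | toReal m ∈ (σ : Cone M) ∧ ∀ F : 𝓜.fan.cones, 𝓜.fan.IsFacet F →
        toReal m ∈ (F : Cone M) → m ∈ s2Closure (𝓜.S F)} := by
  ext m
  constructor
  · intro hm
    refine ⟨toReal_mem hm, fun F hF hmF => ?_⟩
    have hmS : m ∈ 𝓜.S F := mem_of_toReal_mem hm hmF
    exact ⟨⟨m, hmS, 0, zero_mem _, (sub_zero m).symm⟩, fun τ _ =>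
      ⟨m, hmS, 0, zero_mem _, by rw [toReal_zero]; exact zero_mem _, (sub_zero m).symm⟩⟩
  · rintro ⟨hmσ, hm⟩
    -- Membership of m in S'_F supplies a denominator t ∈ S_ρ with t + m ∈ S_F when ρ is F or a
    -- codimension one face of F. If no facet of A contains ρ, an interior monomial of ρ vanishes on
    -- all of A.
    let A : Set 𝓜.fan.cones := {F | 𝓜.fan.IsFacet F ∧ toReal m ∈ (F : Cone M)}
    obtain ⟨r, hr⟩ := exists_proj_eq_single h A m fun ρ hρ => by
      by_cases hex : ∃ F₀ ∈ A, (ρ : Cone M) ≤ F₀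
      · obtain ⟨F₀, hF₀, hle⟩ := hex
        obtain ⟨⟨s, hs, t, ht, hst⟩, hcodim⟩ := hm F₀ hF₀.1 hF₀.2
        obtain ⟨s, hs, t, ht, hst⟩ : ∃ s ∈ 𝓜.S F₀, ∃ t ∈ 𝓜.S ρ, m = s - t := by
          rcases hρ F₀ hF₀.1 hle with rfl | hc
          · exact ⟨s, hs, t, ht, hst⟩
          · rw [𝓜.generates F₀] at hcodim
            obtain ⟨s, hs, t, ht, htρ, hst⟩ := hcodim ρ hc
            exact ⟨s, hs, t, mem_of_toReal_mem ht htρ, hst⟩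
        have htF₀ := S_mono hle ht
        have hsum : t + m ∈ 𝓜.S F₀ := by rw [hst, add_sub_cancel]; exact hs
        refine ⟨t, ht, chi_mem_monomialColon_of_add_mem (fun F hF => hF.2) hF₀ htF₀ hsum
          fun F hF hmem => ⟨hF, (mem_of_add_mem_S htF₀ hF₀.2 hmem).2⟩⟩
      · obtain ⟨u, huS, hu⟩ := exists_isOrderUnit ρ
        exact ⟨u, huS, chi_mem_monomialColon_of_forall_notMem fun F hF hmem =>
          hex ⟨F, hF, le_of_isOrderUnit_mem hu (toReal_mem hmem)⟩⟩
    obtain ⟨F, hF, hle⟩ := 𝓜.fan.exists_facet_ge σ.2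
    have h1 := hr ⟨F, hF.mem⟩ hF
    rw [if_pos ⟨hF, hle hmσ⟩] at h1
    have h2 : m ∈ 𝓜.S ⟨F, hF.mem⟩ := by
      refine mem_of_coeff_proj_ne (k := k) (r := r) ?_
      rw [h1, AddMonoidAlgebra.coeff_single, Finsupp.single_eq_same]
      exact one_ne_zero
    exact mem_of_toReal_mem h2 hmσ

theorem isOneConnected_of_dvdInCodimOne (h : DvdInCodimOne (ToricFaceRing k 𝓜)) :
    𝓜.fan.IsOneConnected := by
  intro F F' hF hF' hne
  -- A consists of the facets reachable from F by chains through F ∩ F'.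
  let A : Set 𝓜.fan.cones := {C | ∃ (n : ℕ) (G : ℕ → Cone M), G 0 = F ∧ G n = C ∧
      (∀ i ≤ n, 𝓜.fan.IsFacet (G i) ∧ F ⊓ F' ≤ G i) ∧
      (∀ i < n, IsCodimOneFace (G i ⊓ G (i + 1)) (G i) ∧
        IsCodimOneFace (G i ⊓ G (i + 1)) (G (i + 1)))}
  by_contra hcon
  have hFA : (⟨F, hF.mem⟩ : 𝓜.fan.cones) ∈ A :=
    ⟨0, fun _ => F, rfl, rfl, fun i _ => ⟨hF, inf_le_left⟩, fun i hi => absurd hi (by omega)⟩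
  have hF'A : (⟨F', hF'.mem⟩ : 𝓜.fan.cones) ∉ A := hcon
  have hAfacet : ∀ G ∈ A, 𝓜.fan.IsFacet (G : Cone M) ∧ F ⊓ F' ≤ (G : Cone M) := by
    rintro G ⟨n, H, -, hn, hH, -⟩
    rw [← hn]
    exact hH n le_rfl
  have hstep : ∀ G ∈ A, ∀ C : 𝓜.fan.cones, 𝓜.fan.IsFacet C → F ⊓ F' ≤ (C : Cone M) →
      IsCodimOneFace ((G : Cone M) ⊓ C) G → IsCodimOneFace ((G : Cone M) ⊓ C) C → C ∈ A := by
    rintro G ⟨n, H, h0, hn, hH, hc⟩ C hC hle h1 h2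
    refine ⟨n + 1, fun i => if i ≤ n then H i else C, by simpa using h0, by simp,
      fun i _ => ?_, fun i hi => ?_⟩
    · by_cases hin : i ≤ n
      · simpa only [if_pos hin] using hH i hin
      · simpa only [if_neg hin] using ⟨hC, hle⟩
    · rcases Nat.lt_succ_iff_lt_or_eq.1 hi with hin | rfl
      · simpa only [if_pos hin.le, if_pos (Nat.succ_le_of_lt hin)] using hc i hin
      · simpa only [if_pos le_rfl, if_neg (Nat.not_succ_le_self i), hn] using ⟨h1, h2⟩
  let ρ₀ : 𝓜.fan.cones := ⟨F ⊓ F', Fan.inf_mem hF.mem hF'.mem⟩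
  obtain ⟨m, hmS, hm⟩ := exists_isOrderUnit ρ₀
  have hmA : ∀ G ∈ A, toReal m ∈ (G : Cone M) := fun G hG => (hAfacet G hG).2 hm.1
  obtain ⟨r, hr⟩ := exists_proj_eq_single h A m fun ρ hρ => by
    obtain ⟨u, huS, hu⟩ := exists_isOrderUnit ρ
    refine ⟨u, huS, ?_⟩
    by_cases hex : ∃ G₀ ∈ A, (ρ : Cone M) ≤ G₀
    · obtain ⟨G₀, hG₀, hle⟩ := hex
      have huG₀ := S_mono hle huS
      refine chi_mem_monomialColon_of_add_mem hmA hG₀ huG₀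
        (add_mem huG₀ (mem_of_toReal_mem hmS (hmA G₀ hG₀))) fun G hG hsum => ?_
      obtain ⟨huG, hmG⟩ := mem_of_add_mem_S huG₀ (hmA G₀ hG₀) hsum
      have hρG : (ρ : Cone M) ≤ G := le_of_isOrderUnit_mem hu (toReal_mem huG)
      have hρ₀G : F ⊓ F' ≤ (G : Cone M) := le_of_isOrderUnit_mem (σ := ρ₀) hm hmG
      by_cases heq : G₀ = G
      · exact heq ▸ hG₀
      have hnle : ¬ (G₀ : Cone M) ≤ G := fun hle' =>
        heq (Subtype.ext ((hAfacet G₀ hG₀).1.eq_of_le G.2 hle'))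
      have hc₀ := (hρ G₀ (hAfacet G₀ hG₀).1 hle).resolve_left fun h => hnle (h ▸ hρG)
      have hc := (hρ G hG hρG).resolve_left fun h =>
        heq (Subtype.ext (hG.eq_of_le G₀.2 (h ▸ hle))).symm
      -- A facet G other than G₀ on which χ^(u+m) survives meets G₀ exactly in ρ, of codimension one
      -- in both, so G is reachable too.
      have hinf : (G₀ : Cone M) ⊓ G = ρ :=
        (hc₀.eq_or_eq (𝓜.fan.inter_face G₀ G₀.2 G G.2).1 (le_inf hle hρG)).resolve_right
          fun h => hnle (inf_eq_left.1 h)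
      exact hstep G₀ hG₀ G hG hρ₀G (hinf ▸ hc₀) (hinf ▸ hc)
    · exact chi_mem_monomialColon_of_forall_notMem fun G hG hmem =>
        hex ⟨G, hG, le_of_isOrderUnit_mem hu (toReal_mem hmem)⟩
  have h1 := hr ⟨F, hF.mem⟩ hF
  have h2 := hr ⟨F', hF'.mem⟩ hF'
  rw [if_pos hFA] at h1
  rw [if_neg hF'A] at h2
  -- The point m belongs to both S_F and S_F', so its coefficient can be read off on either facet,
  -- with contradictory values.
  have h3 : coeffAt r m = 1 := by
    rw [← coeff_proj_of_mem (σ := ⟨F, hF.mem⟩) r (S_mono inf_le_left hmS), h1,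
      AddMonoidAlgebra.coeff_single, Finsupp.single_eq_same]
  have h4 : coeffAt r m = 0 := by
    rw [← coeff_proj_of_mem (σ := ⟨F', hF'.mem⟩) r (S_mono inf_le_right hmS), h2]
    rfl
  exact one_ne_zero (h3.symm.trans h4)

end ToricFaceRing

end ToricFace

end

theorem theorem2p10 {k : Type*} [Field k] {M : Type*} [AddCommGroup M] [Module.Free ℤ M]
    [Module.Finite ℤ M] (𝓜 : ToricFace.MonoidalComplex M) :
    ToricFace.SatisfiesSerre (ToricFace.toricVariety k 𝓜) 2 ↔
      𝓜.fan.IsOneConnected ∧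
      ∀ σ : 𝓜.fan.cones, (𝓜.S σ : Set M) =
        {m | ToricFace.toReal m ∈ (σ : ToricFace.Cone M) ∧
          ∀ F : 𝓜.fan.cones, 𝓜.fan.IsFacet F → ToricFace.toReal m ∈ (F : ToricFace.Cone M) →
            m ∈ ToricFace.s2Closure (𝓜.S F)} := by
  rw [ToricFace.ToricFaceRing.satisfiesSerre_iff]
  exact ⟨fun h => ⟨ToricFace.ToricFaceRing.isOneConnected_of_dvdInCodimOne h,
    ToricFace.ToricFaceRing.eq_setOf_of_dvdInCodimOne h⟩,
    fun h => ToricFace.ToricFaceRing.dvdInCodimOne_of_isOneConnected h.1 h.2⟩
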